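/- **Proposition 1.3.** Fix $\beta>0$. For $n\ge 2$ and $1\le i\le n$ let $a_{n,i},b_{n,i},c_{n,i}$ be real numbers such that the following matrix $K_{n,i}$ on $\{0,1,\dots,2n\}$ is an irreducible stochastic matrix: $$K_{n,i}(j,j+1)=1-a_{n,i}\ \ (0\le j<2n,\ j\ne n),\qquad K_{n,i}(0,0)=a_{n,i},\qquad K_{n,i}(j,j-1)=a_{n,i}\ \ (1\le j\le 2n),$$ $$K_{n,i}(n,n+1)=b_{n,i}n^{-\beta},\qquad K_{n,i}(n,2n)=1-a_{n,i}-b_{n,i}n^{-\beta},$$ $$K_{n,i}(2n,n)=c_{n,i},\qquad K_{n,i}(2n,2n)=1-a_{n,i}-c_{n,i},$$ all other entries being $0$. Let $\pi_{n,i}$ be its stationary distribution, and assume the reversibility condition $$b_{n,i}c_{n,i}(1-a_{n,i})^{n-1}n^{-\beta}=(1-a_{n,i}-b_{n,i}n^{-\beta})\,a_{n,i}^{\,n}.$$ Suppose that there is $C>1$ such that, for all $n\ge 2$ and $1\le i\le n$, $$\sum_{k=1}^n a_{n,k}\le C n^{-\beta-1},\qquad C^{-1}\le b_{n,i}\le C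 .$$ For positive weights $p_{n,1},\dots,p_{n,n}$ put $q_n=p_{n,1}+\cdots+p_{n,n}$, $\mathcal X_n=\{0,\dots,2n\}^n$, $\pi_n=\pi_{n,1}\times\cdots\times\pi_{n,n}$ and $$K_n=\sum_{i=1}^n\frac{p_{n,i}}{q_n}\,I\otimes\cdots\otimes I\otimes K_{n,i}\otimes I\otimes\cdots\otimes I\qquad(K_{n,i}\text{ in the }i\text{-th place}).$$ Let $H_{n,t}=e^{-t(I-K_n)}$ and $d_n(t)=\sup_{x\in\mathcal X_n,\,A\subset\mathcal X_n}\{H_{n,t}(x,A)-\pi_n(A)\}$ for $t\ge0$. A sequence $(t_n)$ with $t_n>0$ for all large $n$ is called a *cutoff time* if $d_n(rt_n)\to0$ for every $r>1$ and $d_n(rt_n)\to1$ for every $r\in(0,1)$; the family of continuous time chains $(\mathcal X_n,H_{n,t},\pi_n)_{n}$ is said to have a *total variation cutoff* if it has a cutoff time. Then the following hold. 1. For $p_{n,i}=1+2^{i-n}$, there is a total variation cutoff if and only if $\beta\ne1$. If $\beta\in(0,1)$, then $2n^2$ is a cutoff time; if $\beta\in(1,\infty)$, then $n^2$ is a cutoff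 time. 2. For every $\alpha>0$ and $p_{n,i}=1+(i/n)^\alpha$, there is a total variation cutoff if and only if $\beta\ne1$. If $\beta\in(0,1)$, then $2\,\frac{\alpha+2}{\alpha+1}\,n^2$ is a cutoff time; if $\beta\in(1,\infty)$, then $\frac{\alpha+2}{\alpha+1}\,n^2$ is a cutoff time. 3. For $p_{n,i}=1+\log i/\log n$, for every $\beta>0$ there is a total variation cutoff, with cutoff time $4n^2/(1+\min\{\beta,1\})$. -/

import Mathlib

open Filter Topology

noncomputable section

/-- The Lacoin-type transition matrix on `{0, 1, …, 2n}` (meaningful for `n ≥ 2`).  Nearest-neighbour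
moves go right with probability `1 - a` and left with probability `a` (with holding `a` at `0`),
except that from `n` one moves to `n + 1` with probability `b * n ^ (-β)` and jumps to `2n` with
probability `1 - a - b * n ^ (-β)`, and from `2n` one jumps to `n` with probability `c` and stays
with probability `1 - a - c`. -/
def lacoinKernel (β : ℝ) (n : ℕ) (a b c : ℝ) :
    Matrix (Fin (2 * n + 1)) (Fin (2 * n + 1)) ℝ := fun j k =>
  if (j : ℕ) = n then
    if (k : ℕ) + 1 = j then a
    else if (k : ℕ) = n + 1 then b * (n : ℝ) ^ (-β)
    else if (k : ℕ) = 2 * n then 1 - a - b * (n : ℝ) ^ (-β)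
    else 0
  else if (j : ℕ) = 2 * n then
    if (k : ℕ) + 1 = j then a
    else if (k : ℕ) = n then c
    else if (k : ℕ) = 2 * n then 1 - a - c
    else 0
  else
    if (k : ℕ) = j + 1 then 1 - a
    else if (k : ℕ) + 1 = j then a
    else if (j : ℕ) = 0 ∧ (k : ℕ) = 0 then a
    else 0

/-- `π` is a probability vector with `π K = π`. -/
def IsStationaryDistribution {X : Type*} [Fintype X] (K : Matrix X X ℝ) (π : X → ℝ) : Prop :=
  π ∈ stdSimplex ℝ X ∧ Matrix.vecMul π K = π

/-- `(X, K, π)` is an irreducible Markov chain with stationary distribution `π`. -/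
def IsIrreducibleChain {X : Type*} [Fintype X] [DecidableEq X]
    (K : Matrix X X ℝ) (π : X → ℝ) : Prop :=
  K ∈ Matrix.rowStochastic ℝ X ∧ K.IsIrreducible ∧ IsStationaryDistribution K π

/-- The product transition matrix `∑ i, w i • I ⊗ ⋯ ⊗ I ⊗ K i ⊗ I ⊗ ⋯ ⊗ I`
(with `K i` at the `i`-th place). -/
def productKernel {ι : Type*} [Fintype ι] [DecidableEq ι] {X : ι → Type*}
    [∀ i, DecidableEq (X i)] (w : ι → ℝ) (K : ∀ i, Matrix (X i) (X i) ℝ) :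
    Matrix (∀ i, X i) (∀ i, X i) ℝ := fun x y =>
  ∑ i, w i * (K i (x i) (y i) *
    ∏ j ∈ Finset.univ.erase i, (1 : Matrix (X j) (X j) ℝ) (x j) (y j))

/-- The product of the probability vectors `π i`. -/
def productDistribution {ι : Type*} [Fintype ι] {X : ι → Type*} (π : ∀ i, X i → ℝ) :
    (∀ i, X i) → ℝ := fun x => ∏ i, π i (x i)

/-- The semigroup `H_t = exp (-t (I - K))` of the associated continuous time chain. -/
def heatKernel {X : Type*} [Fintype X] [DecidableEq X] (K : Matrix X X ℝ) (t : ℝ) :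
    Matrix X X ℝ :=
  NormedSpace.exp ((-t) • ((1 : Matrix X X ℝ) - K))

/-- The (maximum) total variation distance `sup_{x, A} (H_t(x, A) - π(A))` of the continuous time
chain associated with `(X, K, π)`. -/
def tvDistance {X : Type*} [Fintype X] [DecidableEq X] (K : Matrix X X ℝ) (π : X → ℝ)
    (t : ℝ) : ℝ :=
  ⨆ q : X × Finset X, (∑ y ∈ q.2, heatKernel K t q.1 y - ∑ y ∈ q.2, π y)

/-- `t` is a cutoff time for a family of continuous time chains, whose `n`-th member has
distance `d n s` to stationarity at time `s`. -/
def IsCutoffTime (d : ℕ → ℝ → ℝ) (t : ℕ → ℝ) : Prop :=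
  (∀ᶠ n in atTop, 0 < t n) ∧
  (∀ r : ℝ, 1 < r → Tendsto (fun n => d n (r * t n)) atTop (𝓝 0)) ∧
  (∀ r : ℝ, 0 < r → r < 1 → Tendsto (fun n => d n (r * t n)) atTop (𝓝 1))

/-- The family presents a cutoff if it has some cutoff time. -/
def HasCutoff (d : ℕ → ℝ → ℝ) : Prop := ∃ t : ℕ → ℝ, IsCutoffTime d t

/-- The total variation distance at time `t` of the continuous time chain associated with the
product of the chains `lacoinKernel β n (a n i) (b n i) (c n i)`, `1 ≤ i ≤ n`, according to the
probability vector `(p n 1 / q n, …, p n n / q n)`, where `q n = p n 1 + ⋯ + p n n`. -/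
def lacoinProductDistance (β : ℝ) (a b c : ℕ → ℕ → ℝ)
    (π : ∀ n : ℕ, ℕ → Fin (2 * n + 1) → ℝ) (p : ℕ → ℕ → ℝ) (n : ℕ) (t : ℝ) : ℝ :=
  tvDistance
    (productKernel (fun i : Fin n => p n (i + 1) / ∑ k ∈ Finset.Icc 1 n, p n k)
      (fun i : Fin n => lacoinKernel β n (a n (i + 1)) (b n (i + 1)) (c n (i + 1))))
    (productDistribution (fun i : Fin n => π n (i + 1))) t

end

/-! ### The continuous-time semigroup and its Poisson representation. -/

section MarkovChains

open scoped Matrix.Norms.Operator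
open Matrix

variable {X : Type*} [Fintype X] [DecidableEq X]

/-! Each component chain drifts to the right, and reversibility forces `c ≤ a` for large `n`
(`c_le_a`). Since the `a n i` sum to at most `C n ^ (-β - 1)`, the product law gives mass tending to
`1` to the corner `z = (2n, …, 2n)` (`exp_le_productDistribution`). Hence the distance at time `t`
is, up to `o(1)`, one minus the smallest probability of being at `z`. That probability factorizes
over the coordinates, coordinate `i` running for time `s_i = t p_i / q_n`
(`heatKernel_productKernel`).

From `0` a coordinate reaches `2n` in `n + 1` steps by the jump at `n`, or, with probability of
order `n ^ (-β)`, only after `2n` steps. The Poisson clock concentrates, so the chance of not being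
at `2n` is nearly `1` for `s_i < n`, of order `n ^ (-β)` for `n < s_i < 2n`, and negligible even
after summation over `i` for `s_i > 2n`. Thus one coordinate with `s_i < n` makes the distance close
to `1`, while if all `s_i > n` the distance is governed by `n ^ (-β) * #{i : s_i < 2n}`
(`distance_le`, `le_distance`).

At `t = θ Q n ^ 2` with `q_n ~ Q n` one has `s_i ~ θ p_i n`, so only the number of weights below `2
/ θ` matters. If a positive proportion of the weights is near the minimum `1`, this count has order
`n` for `1 < θ < 2`; then `n ^ (1 - β)` puts the cutoff at `θ = 2` for `β < 1` and at `θ = 1` for `β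
> 1`. For `β = 1` the distance stays away from `0` and `1` on compact parts of the window, and
monotonicity in time excludes a cutoff. For logarithmic weights the count is about `n ^ (2 / θ -
1)`, and comparison with `n ^ β` gives `θ = 2 / (1 + β)` as long as `β < 1`. -/

theorem heatKernel_eq_exp_smul (K : Matrix X X ℝ) (t : ℝ) :
    heatKernel K t = NormedSpace.exp (t • (K - 1)) := by
  unfold heatKernel
  congr 1
  rw [neg_smul, ← smul_neg, neg_sub]

/-- The heat kernel is the Poisson mixture of the powers of the transition matrix. -/
theorem hasSum_heatKernel (K : Matrix X X ℝ) (t : ℝ) (x y : X) :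
    HasSum (fun m : ℕ => Real.exp (-t) * (t ^ m / m.factorial) * (K ^ m) x y)
      (heatKernel K t x y) := by
  have h1 : heatKernel K t = Real.exp (-t) • NormedSpace.exp (t • K) := by
    rw [heatKernel_eq_exp_smul, smul_sub, sub_eq_add_neg, add_comm, Matrix.exp_add_of_commute]
    · have : -(t • (1 : Matrix X X ℝ)) = algebraMap ℝ (Matrix X X ℝ) (-t) := by
        rw [Algebra.algebraMap_eq_smul_one, neg_smul]
      have h : NormedSpace.exp (-(t • (1 : Matrix X X ℝ)))
          = Real.exp (-t) • (1 : Matrix X X ℝ) := by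
        rw [this, Real.exp_eq_exp_ℝ, ← Algebra.algebraMap_eq_smul_one]
        exact (NormedSpace.algebraMap_exp_comm (-t)).symm
      rw [h, smul_mul_assoc, one_mul]
    · exact ((Commute.one_left _).smul_left _).neg_left
  have h2 := NormedSpace.exp_series_hasSum_exp' (𝕂 := ℝ) (t • K)
  have h3 : HasSum (fun m : ℕ => Real.exp (-t) • ((m.factorial : ℝ)⁻¹ • (t • K) ^ m))
      (heatKernel K t) := h1 ▸ h2.const_smul (Real.exp (-t))
  convert! Pi.hasSum.1 (Pi.hasSum.1 h3 x) y using 2 with m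
  simp only [smul_pow, Matrix.smul_apply, smul_eq_mul]
  ring

theorem hasDerivAt_heatKernel (K : Matrix X X ℝ) (t : ℝ) :
    HasDerivAt (heatKernel K) ((K - 1) * heatKernel K t) t := by
  have h := hasDerivAt_exp_smul_const' (K - 1) t
  rw [heatKernel_eq_exp_smul]
  exact h.congr_of_eventuallyEq (Eventually.of_forall fun s => heatKernel_eq_exp_smul K s)

theorem hasDerivAt_heatKernel_apply (K : Matrix X X ℝ) (t : ℝ) (x y : X) :
    HasDerivAt (fun s => heatKernel K s x y) (((K - 1) * heatKernel K t) x y) t :=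
  hasDerivAt_pi.1 (hasDerivAt_pi.1 (hasDerivAt_heatKernel K t) x) y

theorem heatKernel_zero (K : Matrix X X ℝ) : heatKernel K 0 = 1 := by
  rw [heatKernel_eq_exp_smul, zero_smul]
  exact NormedSpace.exp_zero

theorem heatKernel_add (K : Matrix X X ℝ) (s t : ℝ) :
    heatKernel K (s + t) = heatKernel K s * heatKernel K t := by
  simp only [heatKernel_eq_exp_smul, add_smul]
  exact NormedSpace.exp_add_of_commute (((Commute.refl _).smul_left _).smul_right _)

/-- The heat kernel is the only solution of the backward equation. -/
theorem heatKernel_eq_of_hasDerivAt (K : Matrix X X ℝ) (W : ℝ → Matrix X X ℝ) (h0 : W 0 = 1)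
    (hW : ∀ t, HasDerivAt W ((K - 1) * W t) t) (t : ℝ) : W t = heatKernel K t := by
  set L := K - 1
  -- Integrating factor: `exp (-s L) * W s` is constant in `s`.
  have hE : ∀ s, HasDerivAt (fun s : ℝ => NormedSpace.exp (s • (-L)) * W s) 0 s := by
    intro s
    have h := (hasDerivAt_exp_smul_const (-L) s).mul (hW s)
    convert! h using 1
    rw [mul_assoc, neg_mul, mul_neg, neg_add_cancel]
  have hc := is_const_of_deriv_eq_zero (fun s => (hE s).differentiableAt)
    (fun s => (hE s).deriv) t 0
  have hc : NormedSpace.exp (t • (-L)) * W t = 1 := by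
    have h1 : NormedSpace.exp ((0 : ℝ) • (-L)) = 1 := by
      rw [zero_smul]
      exact NormedSpace.exp_zero
    simpa only [h1, h0, mul_one] using hc
  have hinv : NormedSpace.exp (t • L) * NormedSpace.exp (t • (-L)) = 1 := by
    rw [← Matrix.exp_add_of_commute]
    · rw [smul_neg, add_neg_cancel]
      exact NormedSpace.exp_zero
    · exact (((Commute.refl _).neg_right).smul_left _).smul_right _
  rw [heatKernel_eq_exp_smul]
  calc W t = NormedSpace.exp (t • L) * NormedSpace.exp (t • (-L)) * W t := by rw [hinv, one_mul]
    _ = NormedSpace.exp (t • L) := by rw [mul_assoc, hc, mul_one]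

theorem hasSum_poisson (t : ℝ) :
    HasSum (fun m : ℕ => Real.exp (-t) * (t ^ m / m.factorial)) 1 := by
  have h := (NormedSpace.expSeries_div_hasSum_exp t).mul_left (Real.exp (-t))
  rwa [← Real.exp_eq_exp_ℝ, ← Real.exp_add, neg_add_cancel, Real.exp_zero] at h

/-- Expectation of `A + D m + B l ^ m` for a Poisson variable `m` of mean `t`. -/
theorem hasSum_poisson_mul (t A B D l : ℝ) :
    HasSum (fun m : ℕ => Real.exp (-t) * (t ^ m / m.factorial) * (A + D * m + B * l ^ m))
      (A + D * t + B * Real.exp (t * (l - 1))) := by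
  have h1 := (hasSum_poisson t).mul_left A
  have h3 : HasSum (fun m : ℕ => B * (Real.exp (-t) * ((t * l) ^ m / m.factorial)))
      (B * Real.exp (t * (l - 1))) := by
    have h := ((NormedSpace.expSeries_div_hasSum_exp (t * l)).mul_left
      (Real.exp (-t))).mul_left B
    rwa [← Real.exp_eq_exp_ℝ, ← Real.exp_add, show -t + t * l = t * (l - 1) by ring] at h
  have h2 : HasSum (fun m : ℕ => D * (Real.exp (-t) * (t ^ m / m.factorial) * m)) (D * t) := by
    refine HasSum.mul_left D ?_
    -- The term `m = 0` vanishes, and in the others the factor `m` cancels against the factorial,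
    -- leaving `t` times the Poisson weights.
    rw [← hasSum_nat_add_iff' 1]
    have h := (hasSum_poisson t).mul_left t
    simp only [mul_one] at h
    simp only [Finset.range_one, Finset.sum_singleton, Nat.cast_zero, mul_zero, sub_zero]
    convert! h using 2 with m
    rw [Nat.factorial_succ]
    have : (m.factorial : ℝ) ≠ 0 := by positivity
    push_cast
    field_simp
    ring
  convert! (h1.add h2).add h3 using 1
  · funext m
    rw [mul_pow]
    ring
  · ring

end MarkovChains

/-! ### Total variation bounds from one state, and factorization of the product semigroup. -/

section ProductChains

open Matrix

variable {X : Type*} [Fintype X] [DecidableEq X]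

/-- This shape is closed under Poisson averaging: `D * m` pays for a small loss per step, and `B * l
^ m` is an exponential tilt which dominates the indicator of too few or too many jumps. -/
theorem heatKernel_apply_le {K : Matrix X X ℝ} {t : ℝ} (ht : 0 ≤ t) {x y : X} {A B D l : ℝ}
    (h : ∀ m : ℕ, (K ^ m) x y ≤ A + D * m + B * l ^ m) :
    heatKernel K t x y ≤ A + D * t + B * Real.exp (t * (l - 1)) :=
  hasSum_le (fun m => mul_le_mul_of_nonneg_left (h m) (by positivity))
    (hasSum_heatKernel K t x y) (hasSum_poisson_mul t A B D l)

theorem le_heatKernel_apply {K : Matrix X X ℝ} {t : ℝ} (ht : 0 ≤ t) {x y : X} {A B D l : ℝ}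
    (h : ∀ m : ℕ, A + D * m + B * l ^ m ≤ (K ^ m) x y) :
    A + D * t + B * Real.exp (t * (l - 1)) ≤ heatKernel K t x y :=
  hasSum_le (fun m => mul_le_mul_of_nonneg_left (h m) (by positivity))
    (hasSum_poisson_mul t A B D l) (hasSum_heatKernel K t x y)

theorem heatKernel_mem_rowStochastic {K : Matrix X X ℝ} (hK : K ∈ rowStochastic ℝ X) {t : ℝ}
    (ht : 0 ≤ t) : heatKernel K t ∈ rowStochastic ℝ X := by
  rw [mem_rowStochastic_iff_sum]
  refine ⟨fun x y => ?_, fun x => ?_⟩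
  · refine (hasSum_heatKernel K t x y).nonneg fun m => ?_
    have := nonneg_of_mem_rowStochastic (pow_mem hK m) (i := x) (j := y)
    positivity
  · have h := hasSum_sum (s := Finset.univ) fun y _ => hasSum_heatKernel K t x y
    refine h.unique ?_
    convert! hasSum_poisson t using 2 with m
    rw [← Finset.mul_sum, sum_row_of_mem_rowStochastic (pow_mem hK m), mul_one]

/-- Every entry of the heat kernel of a stochastic matrix is at most `1`. -/
theorem heatKernel_le_one {K : Matrix X X ℝ} (hK : K ∈ rowStochastic ℝ X) {t : ℝ}
    (ht : 0 ≤ t) (x y : X) : heatKernel K t x y ≤ 1 :=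
  le_one_of_mem_rowStochastic (heatKernel_mem_rowStochastic hK ht)

theorem heatKernel_nonneg {K : Matrix X X ℝ} (hK : K ∈ rowStochastic ℝ X) {t : ℝ}
    (ht : 0 ≤ t) (x y : X) : 0 ≤ heatKernel K t x y :=
  nonneg_of_mem_rowStochastic (heatKernel_mem_rowStochastic hK ht)

theorem le_tvDistance (K : Matrix X X ℝ) (π : X → ℝ) (t : ℝ) (x : X) (A : Finset X) :
    ∑ y ∈ A, heatKernel K t x y - ∑ y ∈ A, π y ≤ tvDistance K π t :=
  le_ciSup (f := fun q : X × Finset X => ∑ y ∈ q.2, heatKernel K t q.1 y - ∑ y ∈ q.2, π y)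
    (Set.finite_range _).bddAbove (x, A)

/-- A set containing `z` has stationary mass at least `π z`; a set avoiding `z` has heat-kernel mass
at most `1 - P`. This is sharp enough when `π` is almost a point mass. -/
theorem tvDistance_le_max [Nonempty X] {K : Matrix X X ℝ} (hK : K ∈ rowStochastic ℝ X)
    {π : X → ℝ} (hπ : π ∈ stdSimplex ℝ X) {t : ℝ} (ht : 0 ≤ t) {z : X} {P : ℝ}
    (hP : ∀ x, P ≤ heatKernel K t x z) : tvDistance K π t ≤ max (1 - π z) (1 - P) := by
  have hH := heatKernel_mem_rowStochastic hK ht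
  refine ciSup_le fun ⟨x, A⟩ => ?_
  by_cases hz : z ∈ A
  · refine le_max_of_le_left ?_
    have h1 : ∑ y ∈ A, heatKernel K t x y ≤ 1 := by
      rw [← sum_row_of_mem_rowStochastic hH x]
      exact Finset.sum_le_sum_of_subset_of_nonneg (Finset.subset_univ _) fun y _ _ => hH.1 x y
    have h2 : π z ≤ ∑ y ∈ A, π y := Finset.single_le_sum (fun y _ => hπ.1 y) hz
    exact sub_le_sub h1 h2
  · refine le_max_of_le_right ?_
    have h1 : heatKernel K t x z + ∑ y ∈ A, heatKernel K t x y ≤ 1 := by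
      rw [← Finset.sum_insert hz, ← sum_row_of_mem_rowStochastic hH x]
      exact Finset.sum_le_sum_of_subset_of_nonneg (Finset.subset_univ _) fun y _ _ => hH.1 x y
    have h2 : 0 ≤ ∑ y ∈ A, π y := Finset.sum_nonneg fun y _ => hπ.1 y
    have := hP x
    dsimp only
    linarith

/-- The test set is the complement of `z`. -/
theorem sub_le_tvDistance {K : Matrix X X ℝ} (hK : K ∈ rowStochastic ℝ X)
    {π : X → ℝ} (hπ : π ∈ stdSimplex ℝ X) {t : ℝ} (ht : 0 ≤ t) (x z : X) :
    π z - heatKernel K t x z ≤ tvDistance K π t := by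
  have h1 := Finset.sum_erase_add Finset.univ (heatKernel K t x) (Finset.mem_univ z)
  have h2 := Finset.sum_erase_add Finset.univ π (Finset.mem_univ z)
  rw [sum_row_of_mem_rowStochastic (heatKernel_mem_rowStochastic hK ht)] at h1
  rw [hπ.2] at h2
  have h := le_tvDistance K π t x (Finset.univ.erase z)
  linarith

theorem tvDistance_antitone [Nonempty X] {K : Matrix X X ℝ} (hK : K ∈ rowStochastic ℝ X)
    (π : X → ℝ) {s t : ℝ} (hst : s ≤ t) : tvDistance K π t ≤ tvDistance K π s := by
  have hH := heatKernel_mem_rowStochastic hK (sub_nonneg.2 hst)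
  refine ciSup_le fun ⟨x, A⟩ => ?_
  -- By the semigroup property, `H_t(x, ·)` averages `H_s(w, ·)` over starting points `w`.
  have h1 : ∑ y ∈ A, heatKernel K t x y
      = ∑ w, heatKernel K (t - s) x w * ∑ y ∈ A, heatKernel K s w y := by
    conv_lhs => rw [← sub_add_cancel t s, heatKernel_add]
    simp only [Matrix.mul_apply, Finset.mul_sum]
    exact Finset.sum_comm
  have h2 : ∑ y ∈ A, π y = ∑ w, heatKernel K (t - s) x w * ∑ y ∈ A, π y := by
    rw [← Finset.sum_mul, sum_row_of_mem_rowStochastic hH, one_mul]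
  dsimp only
  rw [h1, h2, ← Finset.sum_sub_distrib]
  calc _ ≤ ∑ w, heatKernel K (t - s) x w * tvDistance K π s := by
        refine Finset.sum_le_sum fun w _ => ?_
        rw [← mul_sub]
        exact mul_le_mul_of_nonneg_left (le_tvDistance K π s w A) (hH.1 x w)
    _ = _ := by rw [← Finset.sum_mul, sum_row_of_mem_rowStochastic hH, one_mul]

variable {ι : Type*} [Fintype ι] [DecidableEq ι] {Y : ι → Type*} [∀ i, Fintype (Y i)]
  [∀ i, DecidableEq (Y i)]

/-- The product kernel acts on product functions one coordinate at a time. -/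
theorem sum_productKernel_mul_prod (w : ι → ℝ) (K : ∀ i, Matrix (Y i) (Y i) ℝ)
    (f : ∀ i, Y i → ℝ) (x : ∀ i, Y i) :
    ∑ y, productKernel w K x y * ∏ i, f i (y i)
      = ∑ i, w i * (∑ y, K i (x i) y * f i y) * ∏ j ∈ Finset.univ.erase i, f j (x j) := by
  simp only [productKernel, Finset.sum_mul]
  rw [Finset.sum_comm]
  refine Finset.sum_congr rfl fun i _ => ?_
  -- Each summand is a full product over the coordinates, so the sum over `y` factorizes; identity
  -- factors evaluate `f j` at `x j`.
  have h : ∀ y : ∀ i, Y i, w i * (K i (x i) (y i) * ∏ j ∈ Finset.univ.erase i,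
        (1 : Matrix (Y j) (Y j) ℝ) (x j) (y j)) * ∏ j, f j (y j)
      = w i * ∏ j, (if j = i then K j (x j) (y j) else (1 : Matrix (Y j) (Y j) ℝ) (x j) (y j))
        * f j (y j) := by
    intro y
    rw [Finset.prod_mul_distrib, ← Finset.mul_prod_erase Finset.univ
      (fun j => if j = i then K j (x j) (y j) else (1 : Matrix (Y j) (Y j) ℝ) (x j) (y j))
      (Finset.mem_univ i), Finset.prod_congr rfl fun j hj => if_neg (Finset.ne_of_mem_erase hj)]
    simp only [if_true]
    ring
  rw [Finset.sum_congr rfl fun y _ => h y, ← Finset.mul_sum]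
  have h2 := (Finset.prod_univ_sum (fun j : ι => (Finset.univ : Finset (Y j)))
    (fun j y => (if j = i then K j (x j) y else (1 : Matrix (Y j) (Y j) ℝ) (x j) y) * f j y)).symm
  rw [Fintype.piFinset_univ] at h2
  rw [h2, ← Finset.mul_prod_erase Finset.univ _ (Finset.mem_univ i), mul_assoc]
  congr 2
  · simp
  · refine Finset.prod_congr rfl fun j hj => ?_
    simp [Finset.ne_of_mem_erase hj, Matrix.one_apply]

theorem productKernel_mem_rowStochastic {w : ι → ℝ} (hw : ∀ i, 0 ≤ w i) (hw1 : ∑ i, w i = 1)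
    {K : ∀ i, Matrix (Y i) (Y i) ℝ} (hK : ∀ i, K i ∈ rowStochastic ℝ (Y i)) :
    productKernel w K ∈ rowStochastic ℝ (∀ i, Y i) := by
  rw [mem_rowStochastic_iff_sum]
  refine ⟨fun x y => Finset.sum_nonneg fun i _ => mul_nonneg (hw i) (mul_nonneg ((hK i).1 _ _)
    (Finset.prod_nonneg fun j _ => ?_)), fun x => ?_⟩
  · rw [Matrix.one_apply]; split_ifs <;> norm_num
  · have h := sum_productKernel_mul_prod w K (fun _ _ => 1) x
    simpa [sum_row_of_mem_rowStochastic (hK _), hw1] using h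

/-- The heat kernel of a product chain is the product of the time-changed heat kernels. -/
theorem heatKernel_productKernel {w : ι → ℝ} (hw1 : ∑ i, w i = 1)
    (K : ∀ i, Matrix (Y i) (Y i) ℝ) (t : ℝ) (x z : ∀ i, Y i) :
    heatKernel (productKernel w K) t x z = ∏ i, heatKernel (K i) (t * w i) (x i) (z i) := by
  have key := heatKernel_eq_of_hasDerivAt (productKernel w K)
    (fun t => Matrix.of fun x z => ∏ i, heatKernel (K i) (t * w i) (x i) (z i)) ?_ ?_ t
  · rw [← key, Matrix.of_apply]
  · ext x z
    simp only [zero_mul, heatKernel_zero, Matrix.of_apply, Matrix.one_apply, funext_iff]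
    by_cases h : ∀ i, x i = z i
    · simp [h]
    · rw [if_neg h]
      push Not at h
      obtain ⟨i, hi⟩ := h
      exact Finset.prod_eq_zero (Finset.mem_univ i) (if_neg hi)
  · intro t
    refine hasDerivAt_pi.2 fun x => hasDerivAt_pi.2 fun z => ?_
    have hd : ∀ i ∈ (Finset.univ : Finset ι), HasDerivAt
        (fun t => heatKernel (K i) (t * w i) (x i) (z i))
        (((K i - 1) * heatKernel (K i) (t * w i)) (x i) (z i) * w i) t := by
      intro i _
      exact HasDerivAt.comp t (hasDerivAt_heatKernel_apply (K i) (t * w i) (x i) (z i))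
        (by simpa using (hasDerivAt_id t).mul_const (w i))
    have h := HasDerivAt.fun_finsetProd hd
    convert! h using 1
    rw [Matrix.sub_mul, Matrix.one_mul, Matrix.sub_apply, Matrix.mul_apply]
    simp only [Matrix.of_apply]
    rw [sum_productKernel_mul_prod w K (fun i y => heatKernel (K i) (t * w i) y (z i))]
    -- As the weights sum to `1`, the term coming from `-1` in `K - 1` can be shared out among the
    -- coordinates, matching the Leibniz rule term by term.
    have h3 : ∏ i, heatKernel (K i) (t * w i) (x i) (z i) = ∑ i, w i *
        heatKernel (K i) (t * w i) (x i) (z i) *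
        ∏ j ∈ Finset.univ.erase i, heatKernel (K j) (t * w j) (x j) (z j) := by
      simp only [mul_assoc, Finset.mul_prod_erase Finset.univ
        (fun j => heatKernel (K j) (t * w j) (x j) (z j)) (Finset.mem_univ _)]
      rw [← Finset.sum_mul, hw1, one_mul]
    rw [h3, ← Finset.sum_sub_distrib]
    refine Finset.sum_congr rfl fun i _ => ?_
    rw [Matrix.sub_mul, Matrix.one_mul, Matrix.sub_apply, Matrix.mul_apply, smul_eq_mul]
    ring

end ProductChains

/-! ### Products of numbers close to one. -/

section ProductBounds

variable {ι : Type*} [Fintype ι]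

theorem productDistribution_mem_stdSimplex [DecidableEq ι] {Y : ι → Type*} [∀ i, Fintype (Y i)]
    {π : ∀ i, Y i → ℝ}
    (hπ : ∀ i, π i ∈ stdSimplex ℝ (Y i)) :
    productDistribution π ∈ stdSimplex ℝ (∀ i, Y i) := by
  refine ⟨fun x => Finset.prod_nonneg fun i _ => (hπ i).1 _, ?_⟩
  have h2 := (Finset.prod_univ_sum (fun j : ι => (Finset.univ : Finset (Y j))) π).symm
  rw [Fintype.piFinset_univ] at h2
  simp only [productDistribution]
  rw [h2]
  exact Finset.prod_eq_one fun i _ => (hπ i).2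

theorem prod_le_exp_neg_sum {f e : ι → ℝ} (h0 : ∀ i, 0 ≤ f i)
    (he : ∀ i, f i ≤ 1 - e i) : ∏ i, f i ≤ Real.exp (-∑ i, e i) := by
  rw [← Finset.sum_neg_distrib, Real.exp_sum]
  exact Finset.prod_le_prod (fun i _ => h0 i) fun i _ =>
    (he i).trans (Real.one_sub_le_exp_neg _)

/-- Indeed `(1 + 2x)(1 - x) ≥ 1` on `[0, 1/2]`. -/
theorem exp_neg_two_mul_le {x : ℝ} (h0 : 0 ≤ x) (h : x ≤ 1 / 2) : Real.exp (-(2 * x)) ≤ 1 - x := by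
  have h1 : 1 + 2 * x ≤ Real.exp (2 * x) := by linarith [Real.add_one_le_exp (2 * x)]
  rw [Real.exp_neg]
  refine (inv_anti₀ (by positivity) h1).trans ?_
  rw [inv_le_iff_one_le_mul₀ (by positivity)]
  nlinarith

theorem exp_neg_sum_le_prod {f e : ι → ℝ} (h0 : ∀ i, 0 ≤ e i) (h1 : ∀ i, e i ≤ 1 / 2)
    (he : ∀ i, 1 - e i ≤ f i) : Real.exp (-(2 * ∑ i, e i)) ≤ ∏ i, f i := by
  rw [Finset.mul_sum, ← Finset.sum_neg_distrib, Real.exp_sum]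
  exact Finset.prod_le_prod (fun i _ => (Real.exp_pos _).le) fun i _ =>
    (exp_neg_two_mul_le (h0 i) (h1 i)).trans (he i)

end ProductBounds

/-! ### One component chain: fast path, slow path and Poisson clock. -/

section SingleChain

open Matrix

variable {X : Type*} [Fintype X] [DecidableEq X]

/-- One transition gives a lower bound for the next power. -/
theorem mul_le_pow_succ_apply {K : Matrix X X ℝ} (hK : K ∈ rowStochastic ℝ X) (m : ℕ) (j k z : X) :
    K j k * (K ^ m) k z ≤ (K ^ (m + 1)) j z := by
  rw [pow_succ', Matrix.mul_apply]
  exact Finset.single_le_sum (f := fun k => K j k * (K ^ m) k z)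
    (fun i _ => mul_nonneg (hK.1 _ _) (nonneg_of_mem_rowStochastic (pow_mem hK m)))
    (Finset.mem_univ k)

/-- Needed at the branching state `n`, where both exits to the right are counted. -/
theorem add_mul_le_pow_succ_apply {K : Matrix X X ℝ} (hK : K ∈ rowStochastic ℝ X) (m : ℕ)
    (j z : X) {k l : X} (hkl : k ≠ l) :
    K j k * (K ^ m) k z + K j l * (K ^ m) l z ≤ (K ^ (m + 1)) j z := by
  rw [pow_succ', Matrix.mul_apply, ← Finset.sum_pair hkl (f := fun k => K j k * (K ^ m) k z)]
  exact Finset.sum_le_sum_of_subset_of_nonneg (Finset.subset_univ _) fun i _ _ =>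
    mul_nonneg (hK.1 _ _) (nonneg_of_mem_rowStochastic (pow_mem hK m))

theorem mul_le_one_sub_pow_succ_apply {K : Matrix X X ℝ} (hK : K ∈ rowStochastic ℝ X) (m : ℕ)
    (j k z : X) : K j k * (1 - (K ^ m) k z) ≤ 1 - (K ^ (m + 1)) j z := by
  have h := Finset.single_le_sum (f := fun k => K j k - K j k * (K ^ m) k z)
    (fun i _ => sub_nonneg.2 (mul_le_of_le_one_right (hK.1 _ _)
      (le_one_of_mem_rowStochastic (pow_mem hK m)))) (Finset.mem_univ k)
  rw [Finset.sum_sub_distrib, sum_row_of_mem_rowStochastic hK] at h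
  rw [pow_succ', Matrix.mul_apply, mul_sub, mul_one]
  exact h

variable {β : ℝ} {n : ℕ} {a b c : ℝ}

theorem lacoinKernel_apply_succ {j k : Fin (2 * n + 1)} (hj : (j : ℕ) ≠ n)
    (hk : (k : ℕ) = j + 1) : lacoinKernel β n a b c j k = 1 - a := by
  have hj2 : (j : ℕ) ≠ 2 * n := by omega
  simp [lacoinKernel, hj, hj2, hk]

theorem lacoinKernel_apply_middle_succ {j k : Fin (2 * n + 1)} (hj : (j : ℕ) = n)
    (hk : (k : ℕ) = n + 1) : lacoinKernel β n a b c j k = b * (n : ℝ) ^ (-β) := by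
  simp [lacoinKernel, hj, hk]
  omega

theorem lacoinKernel_apply_middle_last (hn : 2 ≤ n) {j k : Fin (2 * n + 1)} (hj : (j : ℕ) = n)
    (hk : (k : ℕ) = 2 * n) : lacoinKernel β n a b c j k = 1 - a - b * (n : ℝ) ^ (-β) := by
  have h1 : 2 * n + 1 ≠ n := by omega
  have h2 : 2 * n ≠ n + 1 := by omega
  simp [lacoinKernel, hj, hk, h1, h2]

theorem lacoinKernel_apply_last_last (hn : 2 ≤ n) {j k : Fin (2 * n + 1)} (hj : (j : ℕ) = 2 * n)
    (hk : (k : ℕ) = 2 * n) : lacoinKernel β n a b c j k = 1 - a - c := by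
  have h1 : 2 * n ≠ n := by omega
  simp [lacoinKernel, hj, hk, h1]

theorem lacoinKernel_apply_last_middle (hn : 2 ≤ n) {j k : Fin (2 * n + 1)} (hj : (j : ℕ) = 2 * n)
    (hk : (k : ℕ) = n) : lacoinKernel β n a b c j k = c := by
  have h1 : 2 * n ≠ n := by omega
  have h2 : n + 1 ≠ 2 * n := by omega
  simp [lacoinKernel, hj, hk, h1, h2]

theorem lacoinKernel_apply_middle_pred {j k : Fin (2 * n + 1)} (hj : (j : ℕ) = n)
    (hk : (k : ℕ) + 1 = n) : lacoinKernel β n a b c j k = a := by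
  simp [lacoinKernel, hj, hk]

theorem lacoinKernel_apply_eq_zero {j k : Fin (2 * n + 1)} (hj : (j : ℕ) < n)
    (hk : (j : ℕ) + 1 < k) : lacoinKernel β n a b c j k = 0 := by
  have h0 : (j : ℕ) ≠ n := by omega
  have h1 : (j : ℕ) ≠ 2 * n := by omega
  have h2 : (k : ℕ) ≠ j + 1 := by omega
  have h3 : (k : ℕ) + 1 ≠ j := by omega
  have h4 : (k : ℕ) ≠ 0 := by omega
  simp only [lacoinKernel, h0, h1, h2, h3, h4, if_false, and_false]

theorem lacoinKernel_parameters (hn : 2 ≤ n)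
    (hK : lacoinKernel β n a b c ∈ rowStochastic ℝ (Fin (2 * n + 1))) :
    0 ≤ a ∧ 0 ≤ b * (n : ℝ) ^ (-β) ∧
    0 ≤ 1 - a - b * (n : ℝ) ^ (-β) ∧ 0 ≤ c ∧ 0 ≤ 1 - a - c := by
  refine ⟨?_, ?_, ?_, ?_, ?_⟩
  · have := hK.1 ⟨n, by omega⟩ ⟨n - 1, by omega⟩
    rwa [lacoinKernel_apply_middle_pred rfl (by simp; omega)] at this
  · have := hK.1 ⟨n, by omega⟩ ⟨n + 1, by omega⟩
    rwa [lacoinKernel_apply_middle_succ rfl rfl] at this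
  · have := hK.1 ⟨n, by omega⟩ ⟨2 * n, by omega⟩
    rwa [lacoinKernel_apply_middle_last hn rfl rfl] at this
  · have := hK.1 ⟨2 * n, by omega⟩ ⟨n, by omega⟩
    rwa [lacoinKernel_apply_last_middle hn rfl rfl] at this
  · have := hK.1 ⟨2 * n, by omega⟩ ⟨2 * n, by omega⟩
    rwa [lacoinKernel_apply_last_last hn rfl rfl] at this

/-- To the left of `n` a step gains at most one, and the jump from `n` costs a further step, so `2n`
is out of reach before step `n + 1 - j`. -/
theorem lacoinKernel_pow_apply_eq_zero (hn : 2 ≤ n) (m : ℕ) (j : Fin (2 * n + 1)) (h : m + j ≤ n) :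
    (lacoinKernel β n a b c ^ m) j (Fin.last (2 * n)) = 0 := by
  induction m generalizing j with
  | zero =>
    rw [pow_zero, Matrix.one_apply_ne]
    intro hj
    rw [hj, Fin.val_last] at h
    omega
  | succ m ih =>
    rw [pow_succ', Matrix.mul_apply]
    refine Finset.sum_eq_zero fun k _ => ?_
    by_cases hk : (j : ℕ) + 1 < k
    · rw [lacoinKernel_apply_eq_zero (by omega) hk, zero_mul]
    · rw [ih k (by omega), mul_zero]

/-- The slow path: from the left half, the chain enters the right half one step at a time
with probability at least `b n ^ (-β)`. -/
theorem le_one_sub_lacoinKernel_pow_apply (hn : 2 ≤ n)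
    (hK : lacoinKernel β n a b c ∈ rowStochastic ℝ (Fin (2 * n + 1)))
    (m : ℕ) (j : Fin (2 * n + 1)) (h : m + j < 2 * n) :
    (if (j : ℕ) ≤ n then b * (n : ℝ) ^ (-β) else 1) * (1 - a) ^ m
      ≤ 1 - (lacoinKernel β n a b c ^ m) j (Fin.last (2 * n)) := by
  obtain ⟨ha, hB, hB1, hc, hac⟩ := lacoinKernel_parameters hn hK
  have h1a : 0 ≤ 1 - a := by linarith
  induction m generalizing j with
  | zero =>
    rw [pow_zero, pow_zero, Matrix.one_apply_ne]
    · split_ifs <;> linarith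
    · intro hj
      rw [hj, Fin.val_last] at h
      omega
  | succ m ih =>
    have hj1 : (j : ℕ) + 1 < 2 * n + 1 := by omega
    have hstep := mul_le_one_sub_pow_succ_apply hK m j ⟨j + 1, hj1⟩ (Fin.last (2 * n))
    have hi := ih ⟨j + 1, hj1⟩ (by simp only; omega)
    refine le_trans ?_ hstep
    by_cases hjn : (j : ℕ) = n
    · rw [lacoinKernel_apply_middle_succ hjn (by simp [hjn]), if_pos hjn.le]
      rw [if_neg (by simp only; omega), one_mul] at hi
      refine mul_le_mul_of_nonneg_left (le_trans ?_ hi) hB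
      -- The crossing step is paid by `b n ^ (-β)`, so one factor `1 - a` is to spare.
      exact pow_le_pow_of_le_one h1a (by linarith) (Nat.le_succ m)
    · rw [lacoinKernel_apply_succ hjn rfl]
      have : (if (j : ℕ) ≤ n then b * (n : ℝ) ^ (-β) else 1)
          = if (j : ℕ) + 1 ≤ n then b * (n : ℝ) ^ (-β) else 1 := by
        by_cases h : (j : ℕ) ≤ n
        · rw [if_pos h, if_pos (by omega)]
        · rw [if_neg h, if_neg (by omega)]
      rw [this, pow_succ]
      calc _ = (1 - a) * ((if (j : ℕ) + 1 ≤ n then b * (n : ℝ) ^ (-β) else 1) * (1 - a) ^ m) := by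
            ring
        _ ≤ _ := mul_le_mul_of_nonneg_left hi h1a

/-- With enough time left for the slow path, the route taken at `n` is irrelevant. A step to the
right, or staying at `2n`, preserves `2 * n ≤ m + j`, and any other move has probability at most `a
+ c`. -/
theorem pow_le_lacoinKernel_pow_apply (hn : 2 ≤ n)
    (hK : lacoinKernel β n a b c ∈ rowStochastic ℝ (Fin (2 * n + 1)))
    (m : ℕ) (j : Fin (2 * n + 1)) (h : 2 * n ≤ m + j) :
    (1 - (a + c)) ^ m ≤ (lacoinKernel β n a b c ^ m) j (Fin.last (2 * n)) := by
  obtain ⟨ha, hB, hB1, hc, hac⟩ := lacoinKernel_parameters hn hK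
  have h1a : 0 ≤ 1 - a := by linarith
  have h1e : 0 ≤ 1 - (a + c) := by linarith
  induction m generalizing j with
  | zero =>
    have hj : j = Fin.last (2 * n) := Fin.ext (by rw [Fin.val_last]; omega)
    rw [hj]
    simp
  | succ m ih =>
    have hp : 0 ≤ (1 - (a + c)) ^ m := pow_nonneg h1e m
    rw [pow_succ']
    by_cases hj : (j : ℕ) = 2 * n
    · refine le_trans ?_ (mul_le_pow_succ_apply hK m j (Fin.last (2 * n)) _)
      rw [lacoinKernel_apply_last_last hn hj rfl, sub_sub]
      exact mul_le_mul_of_nonneg_left (ih _ (by simp)) h1e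
    have hj1 : (j : ℕ) + 1 < 2 * n + 1 := by omega
    have hi := ih ⟨j + 1, hj1⟩ (by simp only; omega)
    by_cases hjn : (j : ℕ) = n
    · have hi2 := ih (Fin.last (2 * n)) (by simp)
      have hne : (⟨j + 1, hj1⟩ : Fin (2 * n + 1)) ≠ Fin.last (2 * n) := by
        intro h
        have := congrArg Fin.val h
        simp only [Fin.val_last] at this
        omega
      refine le_trans ?_ (add_mul_le_pow_succ_apply hK m j _ hne)
      rw [lacoinKernel_apply_middle_succ hjn (by simp [hjn]),
        lacoinKernel_apply_middle_last hn hjn rfl]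
      nlinarith [mul_le_mul_of_nonneg_left hi hB, mul_le_mul_of_nonneg_left hi2 hB1,
        mul_nonneg hc hp]
    · refine le_trans ?_ (mul_le_pow_succ_apply hK m j ⟨j + 1, hj1⟩ _)
      rw [lacoinKernel_apply_succ hjn rfl]
      exact mul_le_mul (by linarith) hi hp h1a

/-- The fast path uses the jump from `n` to `2n`. -/
theorem pow_sub_le_lacoinKernel_pow_apply (hn : 2 ≤ n)
    (hK : lacoinKernel β n a b c ∈ rowStochastic ℝ (Fin (2 * n + 1)))
    (m : ℕ) (j : Fin (2 * n + 1))
    (h : n + 1 ≤ m + j ∧ (j : ℕ) ≤ n ∨ 2 * n ≤ m + j) :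
    (1 - (a + c)) ^ m - b * (n : ℝ) ^ (-β)
      ≤ (lacoinKernel β n a b c ^ m) j (Fin.last (2 * n)) := by
  obtain ⟨ha, hB, hB1, hc, hac⟩ := lacoinKernel_parameters hn hK
  have h1a : 0 ≤ 1 - a := by linarith
  have h1e : 0 ≤ 1 - (a + c) := by linarith
  induction m generalizing j with
  | zero => exact (sub_le_self _ hB).trans (pow_le_lacoinKernel_pow_apply hn hK 0 j (by omega))
  | succ m ih =>
    have hp : 0 ≤ (1 - (a + c)) ^ m := pow_nonneg h1e m
    have hp1 : (1 - (a + c)) ^ m ≤ 1 := pow_le_one₀ h1e (by linarith)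
    rcases lt_trichotomy (j : ℕ) n with hjn | hjn | hjn
    · have hj1 : (j : ℕ) + 1 < 2 * n + 1 := by omega
      have hi := ih ⟨j + 1, hj1⟩ (by simp only; omega)
      refine le_trans ?_ (mul_le_pow_succ_apply hK m j ⟨j + 1, hj1⟩ _)
      rw [lacoinKernel_apply_succ hjn.ne rfl, pow_succ']
      nlinarith [mul_le_mul_of_nonneg_left hi h1a, mul_nonneg hc hp, mul_nonneg ha hB]
    -- At `n` only the jump is kept, losing `b n ^ (-β)`; from `2n` the estimate without loss
    -- applies for any remaining time.
    · have hi2 := pow_le_lacoinKernel_pow_apply hn hK m (Fin.last (2 * n)) (by simp)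
      refine le_trans ?_ (mul_le_pow_succ_apply hK m j (Fin.last (2 * n)) _)
      rw [lacoinKernel_apply_middle_last hn hjn rfl, pow_succ']
      nlinarith [mul_le_mul_of_nonneg_left hi2 hB1, mul_nonneg hc hp,
        mul_le_mul_of_nonneg_left hp1 hB]
    · exact (sub_le_self _ hB).trans
        (pow_le_lacoinKernel_pow_apply hn hK (m + 1) j (by omega))

theorem one_sub_mul_le_pow {e : ℝ} (h : e ≤ 2) (m : ℕ) : 1 - e * m ≤ (1 - e) ^ m := by
  have := one_add_mul_le_pow (a := -e) (by linarith) m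
  rw [← sub_eq_add_neg] at this
  linarith

/-- Stationarity under `2n` steps, a time sufficient from every state. -/
theorem one_sub_le_stationary_last (hn : 2 ≤ n)
    (hK : lacoinKernel β n a b c ∈ rowStochastic ℝ (Fin (2 * n + 1)))
    {π : Fin (2 * n + 1) → ℝ}
    (hπ : IsStationaryDistribution (lacoinKernel β n a b c) π) :
    1 - 2 * n * (a + c) ≤ π (Fin.last (2 * n)) := by
  obtain ⟨ha, hB, hB1, hc, hac⟩ := lacoinKernel_parameters hn hK
  have hpow : ∀ m : ℕ, Matrix.vecMul π (lacoinKernel β n a b c ^ m) = π := by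
    intro m
    induction m with
    | zero => simp
    | succ m ih => rw [pow_succ, ← Matrix.vecMul_vecMul, ih, hπ.2]
  have h := congrFun (hpow (2 * n)) (Fin.last (2 * n))
  rw [← h, Matrix.vecMul, dotProduct]
  have hb := one_sub_mul_le_pow (e := a + c) (by linarith) (2 * n)
  calc 1 - 2 * n * (a + c) ≤ (1 - (a + c)) ^ (2 * n) := by
        push_cast at hb
        linarith
    _ = ∑ j, π j * (1 - (a + c)) ^ (2 * n) := by rw [← Finset.sum_mul, hπ.1.2, one_mul]
    _ ≤ _ := Finset.sum_le_sum fun j _ => mul_le_mul_of_nonneg_left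
        (pow_le_lacoinKernel_pow_apply hn hK (2 * n) j (by omega)) (hπ.1.1 j)

/-- Chernoff bound for the lower tail of the Poisson distribution. -/
theorem pow_mul_exp_le_of_le {s M ε : ℝ} {N : ℕ} (hM : M = N) (hε : 0 < ε) (hs : (1 + ε) * M ≤ s) :
    (1 + ε) ^ N * Real.exp (s * ((1 + ε)⁻¹ - 1)) ≤ ((1 + ε) * Real.exp (-ε)) ^ N := by
  rw [mul_pow, ← Real.exp_nat_mul, ← hM]
  refine mul_le_mul_of_nonneg_left (Real.exp_le_exp.2 ?_) (by positivity)
  have : (1 + ε)⁻¹ - 1 = -(ε / (1 + ε)) := by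
    field_simp
    ring
  rw [this, mul_neg, mul_neg, neg_le_neg_iff, mul_div_assoc', le_div_iff₀ (by positivity)]
  nlinarith

/-- Chernoff bound for the upper tail of the Poisson distribution. -/
theorem pow_mul_exp_le_of_ge {s M ε : ℝ} {N : ℕ} (hM : M = N) (hε : 0 < ε) (hε1 : ε < 1)
    (hs : s ≤ (1 - ε) * M) :
    (1 - ε) ^ N * Real.exp (s * ((1 - ε)⁻¹ - 1)) ≤ ((1 - ε) * Real.exp ε) ^ N := by
  have h1 : 0 < 1 - ε := by linarith
  rw [mul_pow, ← Real.exp_nat_mul, ← hM]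
  refine mul_le_mul_of_nonneg_left (Real.exp_le_exp.2 ?_) (by positivity)
  have : (1 - ε)⁻¹ - 1 = ε / (1 - ε) := by
    field_simp
    ring
  rw [this, mul_div_assoc', div_le_iff₀ h1]
  nlinarith

/-- More than `n` jumps are necessary; the tilt `(1 - ε) ^ (n - m)` dominates the indicator of that
event. -/
theorem lacoin_heatKernel_zero_last_le_pow (hn : 2 ≤ n)
    (hK : lacoinKernel β n a b c ∈ rowStochastic ℝ (Fin (2 * n + 1)))
    {s ε : ℝ} (hs0 : 0 ≤ s) (hε : 0 < ε) (hε1 : ε < 1)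
    (hs : s ≤ (1 - ε) * n) :
    heatKernel (lacoinKernel β n a b c) s 0 (Fin.last (2 * n)) ≤ ((1 - ε) * Real.exp ε) ^ n := by
  have h1 : 0 < 1 - ε := by linarith
  have h := heatKernel_apply_le (K := lacoinKernel β n a b c) hs0 (x := 0) (y := Fin.last (2 * n))
    (A := 0) (D := 0) (B := (1 - ε) ^ n) (l := (1 - ε)⁻¹) ?_
  · rw [zero_mul, add_zero, zero_add] at h
    exact h.trans (pow_mul_exp_le_of_ge rfl hε hε1 hs)
  · intro m
    rw [zero_mul, add_zero, zero_add]
    rcases le_or_gt m n with hm | hm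
    · rw [lacoinKernel_pow_apply_eq_zero hn m 0 (by simpa using hm)]
      positivity
    · refine (le_one_of_mem_rowStochastic (pow_mem hK m)).trans ?_
      rw [inv_pow, ← div_eq_mul_inv, one_le_div (by positivity)]
      exact pow_le_pow_of_le_one h1.le (by linarith) hm.le

/-- Fewer than `2n` jumps leave the slow path unfinished. For more jumps the trivial bound `1` is
written as `1 - B + B`, so that every error term carries the factor `B = b n ^ (-β)`. -/
theorem lacoin_heatKernel_zero_last_le (hn : 2 ≤ n)
    (hK : lacoinKernel β n a b c ∈ rowStochastic ℝ (Fin (2 * n + 1)))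
    {s ε : ℝ} (hs0 : 0 ≤ s) (hε : 0 < ε) (hε1 : ε < 1)
    (hs : s ≤ (1 - ε) * (2 * n)) :
    heatKernel (lacoinKernel β n a b c) s 0 (Fin.last (2 * n))
      ≤ 1 - b * (n : ℝ) ^ (-β) * (1 - a * s - ((1 - ε) * Real.exp ε) ^ (2 * n)) := by
  obtain ⟨ha, hB, hB1, hc, hac⟩ := lacoinKernel_parameters hn hK
  set B := b * (n : ℝ) ^ (-β) with hBdef
  have h1 : 0 < 1 - ε := by linarith
  have h := heatKernel_apply_le (K := lacoinKernel β n a b c) hs0 (x := 0) (y := Fin.last (2 * n))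
    (A := 1 - B) (D := B * a) (B := B * (1 - ε) ^ (2 * n)) (l := (1 - ε)⁻¹) ?_
  · have h2 := pow_mul_exp_le_of_ge (N := 2 * n) (M := 2 * n) (by push_cast; ring) hε hε1 hs
    nlinarith [mul_le_mul_of_nonneg_left h2 hB]
  · intro m
    have hpos : 0 ≤ (1 - ε) ^ (2 * n) * (1 - ε)⁻¹ ^ m := by positivity
    rcases lt_or_ge m (2 * n) with hm | hm
    · have h3 := le_one_sub_lacoinKernel_pow_apply hn hK m 0 (by simpa using hm)
      rw [if_pos (by simp)] at h3
      have h4 := mul_le_mul_of_nonneg_left (one_sub_mul_le_pow (e := a) (by linarith) m) hB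
      rw [mul_assoc B ((1 - ε) ^ (2 * n))]
      nlinarith [mul_nonneg hB hpos]
    · have h3 := le_one_of_mem_rowStochastic (pow_mem hK m) (i := 0) (j := Fin.last (2 * n))
      have h4 : 1 ≤ (1 - ε) ^ (2 * n) * (1 - ε)⁻¹ ^ m := by
        rw [inv_pow, ← div_eq_mul_inv, one_le_div (by positivity)]
        exact pow_le_pow_of_le_one h1.le (by linarith) hm
      rw [mul_assoc B ((1 - ε) ^ (2 * n))]
      have h5 : 0 ≤ B * a * m := by positivity
      nlinarith [mul_le_mul_of_nonneg_left h4 hB]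

/-- With high probability there are at least `2n` jumps, so both paths are finished and only moves
of probability `a + c` do harm. -/
theorem le_lacoin_heatKernel_last_of_le (hn : 2 ≤ n)
    (hK : lacoinKernel β n a b c ∈ rowStochastic ℝ (Fin (2 * n + 1)))
    {s ε : ℝ} (hs0 : 0 ≤ s) (hε : 0 < ε)
    (hs : (1 + ε) * (2 * n) ≤ s) (j : Fin (2 * n + 1)) :
    1 - ((a + c) * s + ((1 + ε) * Real.exp (-ε)) ^ (2 * n))
      ≤ heatKernel (lacoinKernel β n a b c) s j (Fin.last (2 * n)) := by
  obtain ⟨ha, hB, hB1, hc, hac⟩ := lacoinKernel_parameters hn hK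
  have h := le_heatKernel_apply (K := lacoinKernel β n a b c) hs0 (x := j) (y := Fin.last (2 * n))
    (A := 1) (D := -(a + c)) (B := -(1 + ε) ^ (2 * n)) (l := (1 + ε)⁻¹) ?_
  · have h2 := pow_mul_exp_le_of_le (N := 2 * n) (M := 2 * n) (by push_cast; ring) hε hs
    linarith
  · intro m
    have hpos : 0 ≤ (1 + ε) ^ (2 * n) * (1 + ε)⁻¹ ^ m := by positivity
    rcases le_or_gt (2 * n) m with hm | hm
    · have h3 := pow_le_lacoinKernel_pow_apply hn hK m j (by omega)
      have h4 := one_sub_mul_le_pow (e := a + c) (by linarith) m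
      linarith
    · have h3 := nonneg_of_mem_rowStochastic (pow_mem hK m) (i := j) (j := Fin.last (2 * n))
      have h4 : 1 ≤ (1 + ε) ^ (2 * n) * (1 + ε)⁻¹ ^ m := by
        rw [inv_pow, ← div_eq_mul_inv, one_le_div (by positivity)]
        exact pow_le_pow_right₀ (by linarith) hm.le
      have h5 : 0 ≤ (a + c) * m := by positivity
      linarith

theorem le_lacoin_heatKernel_last (hn : 2 ≤ n)
    (hK : lacoinKernel β n a b c ∈ rowStochastic ℝ (Fin (2 * n + 1)))
    {s ε : ℝ} (hs0 : 0 ≤ s) (hε : 0 < ε)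
    (hs : (1 + ε) * n ≤ s) (j : Fin (2 * n + 1)) :
    1 - (b * (n : ℝ) ^ (-β) + (a + c) * s + ((1 + ε) * Real.exp (-ε)) ^ n)
      ≤ heatKernel (lacoinKernel β n a b c) s j (Fin.last (2 * n)) := by
  obtain ⟨ha, hB, hB1, hc, hac⟩ := lacoinKernel_parameters hn hK
  have h := le_heatKernel_apply (K := lacoinKernel β n a b c) hs0 (x := j) (y := Fin.last (2 * n))
    (A := 1 - b * (n : ℝ) ^ (-β)) (D := -(a + c)) (B := -(1 + ε) ^ n) (l := (1 + ε)⁻¹) ?_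
  · have h2 := pow_mul_exp_le_of_le (N := n) (M := n) rfl hε hs
    linarith
  · intro m
    have hpos : 0 ≤ (1 + ε) ^ n * (1 + ε)⁻¹ ^ m := by positivity
    -- `m ≥ n + 1` covers every start: the fast path if `j ≤ n`, and `2 * n ≤ m + j` if `j > n`.
    rcases lt_or_ge n m with hm | hm
    · have h3 := pow_sub_le_lacoinKernel_pow_apply hn hK m j (by omega)
      have h4 := one_sub_mul_le_pow (e := a + c) (by linarith) m
      linarith
    · have h3 := nonneg_of_mem_rowStochastic (pow_mem hK m) (i := j) (j := Fin.last (2 * n))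
      have h4 : 1 ≤ (1 + ε) ^ n * (1 + ε)⁻¹ ^ m := by
        rw [inv_pow, ← div_eq_mul_inv, one_le_div (by positivity)]
        exact pow_le_pow_right₀ (by linarith) hm
      have h5 : 0 ≤ (a + c) * m := by positivity
      linarith

end SingleChain

/-! ### Non-asymptotic distance bounds for the product chain. -/

section LacoinFamilies

open Matrix

/-- The standing assumptions on the parameters of the component chains. -/
structure IsLacoinFamily (β : ℝ) (a b c : ℕ → ℕ → ℝ)
    (π : ∀ n : ℕ, ℕ → Fin (2 * n + 1) → ℝ) (C : ℝ) : Prop where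
  beta_pos : 0 < β
  one_lt : 1 < C
  chain : ∀ n i : ℕ, 2 ≤ n → 1 ≤ i → i ≤ n →
    IsIrreducibleChain (lacoinKernel β n (a n i) (b n i) (c n i)) (π n i)
  reversible : ∀ n i : ℕ, 2 ≤ n → 1 ≤ i → i ≤ n →
    b n i * c n i * (1 - a n i) ^ (n - 1) * (n : ℝ) ^ (-β)
      = (1 - a n i - b n i * (n : ℝ) ^ (-β)) * a n i ^ n
  sum_le : ∀ n : ℕ, 2 ≤ n → ∑ i ∈ Finset.Icc 1 n, a n i ≤ C * (n : ℝ) ^ (-β - 1)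
  bounds : ∀ n i : ℕ, 2 ≤ n → 1 ≤ i → i ≤ n → C⁻¹ ≤ b n i ∧ b n i ≤ C

theorem sum_fin_succ_eq_sum_Icc (n : ℕ) (f : ℕ → ℝ) :
    ∑ i : Fin n, f (i + 1) = ∑ i ∈ Finset.Icc 1 n, f i := by
  rw [Fin.sum_univ_eq_sum_range (fun i => f (i + 1)) n, Finset.range_eq_Ico,
    Finset.sum_Ico_add' f 0 n 1]
  rfl

/-- The time elapsed in the `i`-th component chain when the product chain has run for time `t`. -/
noncomputable def componentTime (p : ℕ → ℕ → ℝ) (n : ℕ) (t : ℝ) (i : ℕ) : ℝ :=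
  t * (p n i / ∑ k ∈ Finset.Icc 1 n, p n k)

namespace IsLacoinFamily

variable {β : ℝ} {a b c : ℕ → ℕ → ℝ} {π : ∀ n : ℕ, ℕ → Fin (2 * n + 1) → ℝ} {C : ℝ}
  (hF : IsLacoinFamily β a b c π C) {n : ℕ} (hn : 2 ≤ n)

include hF hn

omit hF in
theorem rpow_sub_one : (n : ℝ) ^ (-β - 1) * n = (n : ℝ) ^ (-β) := by
  have : (0 : ℝ) < n := by positivity
  rw [Real.rpow_sub_one this.ne']
  field_simp

theorem a_nonneg {i : ℕ} (h1 : 1 ≤ i) (hi : i ≤ n) : 0 ≤ a n i :=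
  (lacoinKernel_parameters hn (hF.chain n i hn h1 hi).1).1

theorem a_le {i : ℕ} (h1 : 1 ≤ i) (hi : i ≤ n) : a n i ≤ C * (n : ℝ) ^ (-β - 1) := by
  refine le_trans ?_ (hF.sum_le n hn)
  refine Finset.single_le_sum (f := a n) (fun j hj => ?_) (Finset.mem_Icc.2 ⟨h1, hi⟩)
  rw [Finset.mem_Icc] at hj
  exact hF.a_nonneg hn hj.1 hj.2

theorem a_mul_le {i : ℕ} (h1 : 1 ≤ i) (hi : i ≤ n) : a n i * n ≤ C * (n : ℝ) ^ (-β) := by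
  rw [← rpow_sub_one hn, ← mul_assoc]
  exact mul_le_mul_of_nonneg_right (hF.a_le hn h1 hi) (Nat.cast_nonneg n)

theorem sum_mul_le : (∑ i ∈ Finset.Icc 1 n, a n i) * n ≤ C * (n : ℝ) ^ (-β) := by
  rw [← rpow_sub_one hn, ← mul_assoc]
  exact mul_le_mul_of_nonneg_right (hF.sum_le n hn) (Nat.cast_nonneg n)

/-- Reversibility forces the jumps from `2n` back to `n` to be rare. -/
theorem c_le_a (hnC : 2 * C ^ 2 ≤ n) {i : ℕ} (h1 : 1 ≤ i) (hi : i ≤ n) : c n i ≤ a n i := by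
  obtain ⟨ha, hB, hB1, hc, hac⟩ := lacoinKernel_parameters hn (hF.chain n i hn h1 hi).1
  have hC := hF.one_lt
  have hb := (hF.bounds n i hn h1 hi).1
  have hrev := hF.reversible n i hn h1 hi
  have haC := hF.a_mul_le hn h1 hi
  have hn0 : (0 : ℝ) < n := by positivity
  set x := (n : ℝ) ^ (-β) with hx
  have hx0 : 0 < x := Real.rpow_pos_of_pos hn0 _
  have hx1 : x ≤ 1 := Real.rpow_le_one_of_one_le_of_nonpos (by exact_mod_cast (by omega : 1 ≤ n))
    (by linarith [hF.beta_pos])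
  set A := a n i
  -- From `A n ≤ C x` and `2 C ^ 2 ≤ n`.
  have h2a : 2 * A * C ≤ x := by
    have : 2 * A * C * n ≤ x * n := by nlinarith [mul_le_mul_of_nonneg_left hnC hx0.le]
    exact le_of_mul_le_mul_right this hn0
  have h2a1 : 2 * A ≤ 1 := by nlinarith
  have h1a : 0 < 1 - A := by linarith
  -- Here `2 * (1 - A) ≥ 1`; of the powers of `2 * A ≤ 1` a single one is kept, which suffices to
  -- beat `C⁻¹ * x`.
  have hpow : A ^ (n - 1) ≤ 2 * A * (1 - A) ^ (n - 1) := by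
    calc A ^ (n - 1) ≤ (2 * A * (1 - A)) ^ (n - 1) := pow_le_pow_left₀ ha (by nlinarith) _
      _ = (2 * A) ^ (n - 1) * (1 - A) ^ (n - 1) := mul_pow _ _ _
      _ ≤ _ := mul_le_mul_of_nonneg_right
          (pow_le_of_le_one (by positivity) h2a1 (by omega)) (by positivity)
  have hD : 0 < C⁻¹ * (1 - A) ^ (n - 1) * x := by positivity
  refine le_of_mul_le_mul_right ?_ hD
  calc c n i * (C⁻¹ * (1 - A) ^ (n - 1) * x) = C⁻¹ * (c n i * (1 - A) ^ (n - 1) * x) := by ring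
    _ ≤ b n i * (c n i * (1 - A) ^ (n - 1) * x) :=
        mul_le_mul_of_nonneg_right hb (by positivity)
    _ = (1 - A - b n i * x) * A ^ n := by rw [← hrev]; ring
    _ ≤ 1 * A ^ n := mul_le_mul_of_nonneg_right (by linarith) (by positivity)
    _ = A * A ^ (n - 1) := by
        rw [one_mul, ← pow_succ', Nat.sub_add_cancel (by omega)]
    _ ≤ A * (2 * A * (1 - A) ^ (n - 1)) := mul_le_mul_of_nonneg_left hpow ha
    _ ≤ A * (C⁻¹ * (1 - A) ^ (n - 1) * x) := by
        refine mul_le_mul_of_nonneg_left ?_ ha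
        have h3 : 2 * A ≤ C⁻¹ * x := by
          rw [inv_mul_eq_div, le_div_iff₀ (by linarith)]
          exact h2a
        nlinarith [mul_le_mul_of_nonneg_right h3 (pow_nonneg h1a.le (n - 1))]

/-- Each factor is at least `1 - 4 a n` because `c ≤ a`; summing gives `4 C n ^ (-β)`, doubled on
passing to the exponential. -/
theorem exp_le_productDistribution (hnC : 2 * C ^ 2 ≤ n) (hx : 8 * C * (n : ℝ) ^ (-β) ≤ 1) :
    Real.exp (-(8 * C * (n : ℝ) ^ (-β)))
      ≤ productDistribution (fun i : Fin n => π n (i + 1)) (fun _ => Fin.last (2 * n)) := by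
  have h := exp_neg_sum_le_prod (ι := Fin n) (e := fun i => 4 * (a n (i + 1) * n))
    (f := fun i => π n (i + 1) (Fin.last (2 * n))) ?_ ?_ ?_
  · refine le_trans (Real.exp_le_exp.2 ?_) h
    rw [sum_fin_succ_eq_sum_Icc n (fun i => 4 * (a n i * n)), ← Finset.mul_sum, ← Finset.sum_mul]
    linarith [hF.sum_mul_le hn]
  · intro i
    have := hF.a_nonneg hn (i := i + 1) (by omega) (by omega)
    positivity
  · intro i
    have := hF.a_mul_le hn (i := i + 1) (by omega) (by omega)
    linarith
  · intro i
    have hch := hF.chain n (i + 1) hn (by omega) (by omega)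
    have h1 := one_sub_le_stationary_last hn hch.1 hch.2.2
    have h2 := hF.c_le_a hn hnC (i := i + 1) (by omega) (by omega)
    have h3 : (0 : ℝ) ≤ n := Nat.cast_nonneg n
    nlinarith [mul_le_mul_of_nonneg_left h2 h3]

theorem productDistribution_mem :
    productDistribution (fun i : Fin n => π n (i + 1)) ∈ stdSimplex ℝ (Fin n → Fin (2 * n + 1)) :=
  productDistribution_mem_stdSimplex
    fun i => (hF.chain n (i + 1) hn (by omega) (by omega)).2.2.1

section

variable {p : ℕ → ℕ → ℝ} (hp : ∀ i, 1 ≤ i → i ≤ n → 0 < p n i)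

include hp

omit hF in
theorem sum_weights_pos : 0 < ∑ k ∈ Finset.Icc 1 n, p n k :=
  Finset.sum_pos (fun k hk => hp k (Finset.mem_Icc.1 hk).1 (Finset.mem_Icc.1 hk).2)
    ⟨1, Finset.mem_Icc.2 ⟨le_rfl, by omega⟩⟩

omit hF in
theorem componentTime_nonneg {t : ℝ} (ht : 0 ≤ t) {i : ℕ} (h1 : 1 ≤ i) (hi : i ≤ n) :
    0 ≤ componentTime p n t i :=
  mul_nonneg ht (div_nonneg (hp i h1 hi).le (sum_weights_pos hn hp).le)

omit hF in
theorem sum_weights_eq_one : ∑ i : Fin n, p n (i + 1) / ∑ k ∈ Finset.Icc 1 n, p n k = 1 := by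
  rw [sum_fin_succ_eq_sum_Icc n (fun i => p n i / ∑ k ∈ Finset.Icc 1 n, p n k), ← Finset.sum_div,
    div_self (sum_weights_pos hn hp).ne']

theorem productKernel_mem :
    productKernel (fun i : Fin n => p n (i + 1) / ∑ k ∈ Finset.Icc 1 n, p n k)
      (fun i : Fin n => lacoinKernel β n (a n (i + 1)) (b n (i + 1)) (c n (i + 1)))
      ∈ rowStochastic ℝ (Fin n → Fin (2 * n + 1)) :=
  productKernel_mem_rowStochastic
    (fun i : Fin n => div_nonneg (hp (i + 1) (by omega) (by omega)).le (sum_weights_pos hn hp).le)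
    (sum_weights_eq_one hn hp) fun i => (hF.chain n (i + 1) hn (by omega) (by omega)).1

theorem distance_antitone {s t : ℝ} (hst : s ≤ t) :
    lacoinProductDistance β a b c π p n t ≤ lacoinProductDistance β a b c π p n s :=
  tvDistance_antitone (hF.productKernel_mem hn hp) _ hst

theorem distance_le_of_le_prod {t : ℝ} (ht : 0 ≤ t) {P : ℝ}
    (hP : ∀ x : Fin n → Fin (2 * n + 1), P ≤ ∏ i : Fin n,
      heatKernel (lacoinKernel β n (a n (i + 1)) (b n (i + 1)) (c n (i + 1)))
        (componentTime p n t (i + 1)) (x i) (Fin.last (2 * n)))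
    (hP' : P ≤ productDistribution (fun i : Fin n => π n (i + 1)) (fun _ => Fin.last (2 * n))) :
    lacoinProductDistance β a b c π p n t ≤ 1 - P := by
  have h := tvDistance_le_max (hF.productKernel_mem hn hp) (hF.productDistribution_mem hn) ht
    (z := fun _ => Fin.last (2 * n)) (P := P) fun x => by
      rw [heatKernel_productKernel (sum_weights_eq_one hn hp)]
      exact hP x
  exact h.trans (max_le (by linarith) le_rfl)

theorem sub_prod_le_distance {t : ℝ} (ht : 0 ≤ t) :
    productDistribution (fun i : Fin n => π n (i + 1)) (fun _ => Fin.last (2 * n))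
      - ∏ i : Fin n, heatKernel (lacoinKernel β n (a n (i + 1)) (b n (i + 1)) (c n (i + 1)))
        (componentTime p n t (i + 1)) 0 (Fin.last (2 * n))
      ≤ lacoinProductDistance β a b c π p n t := by
  have h := sub_le_tvDistance (hF.productKernel_mem hn hp) (hF.productDistribution_mem hn) ht
    (fun _ => 0) (fun _ => Fin.last (2 * n))
  rwa [heatKernel_productKernel (sum_weights_eq_one hn hp)] at h

/-- Upper bound for the distance in terms of the number of coordinates that had no time to follow
the slow path. -/
theorem distance_le (hnC : 2 * C ^ 2 ≤ n) {t ε M : ℝ} (ht : 0 ≤ t) (hε : 0 < ε) (hM : 0 ≤ M)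
    (hlow : ∀ i, 1 ≤ i → i ≤ n → (1 + ε) * n ≤ componentTime p n t i)
    (hup : ∀ i, 1 ≤ i → i ≤ n → componentTime p n t i ≤ M * n)
    (hsmall : (5 + 2 * M) * (C * (n : ℝ) ^ (-β)) + n * ((1 + ε) * Real.exp (-ε)) ^ n ≤ 1 / 2) :
    lacoinProductDistance β a b c π p n t ≤ 1 - Real.exp (-(2 * (
      (4 + 2 * M) * (C * (n : ℝ) ^ (-β)) + n * ((1 + ε) * Real.exp (-ε)) ^ n
      + C * (n : ℝ) ^ (-β) * (Finset.filter (fun i => componentTime p n t i < (1 + ε) * (2 * n))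
        (Finset.Icc 1 n)).card))) := by
  set ρ := (1 + ε) * Real.exp (-ε) with hρ
  set x := (n : ℝ) ^ (-β) with hx
  have hC := hF.one_lt
  have hn0 : (0 : ℝ) < n := by positivity
  have hx0 : 0 < x := Real.rpow_pos_of_pos hn0 _
  have hρ0 : 0 < ρ := by positivity
  have hρ1 : ρ ≤ 1 := by
    rw [hρ, Real.exp_neg, ← div_eq_mul_inv, div_le_one (Real.exp_pos _)]
    linarith [Real.add_one_le_exp ε]
  have hρn : 0 < ρ ^ n := by positivity
  have hρn1 : ρ ^ n ≤ n * ρ ^ n :=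
    le_mul_of_one_le_left hρn.le (by exact_mod_cast (by omega : 1 ≤ n))
  have hCx : 0 < C * x := by positivity
  have hMCx : 0 ≤ M * (C * x) := by positivity
  -- Error of a coordinate: an unfinished slow path, harmful moves at rate `a + c ≤ 2a` during time
  -- at most `M n`, and the Poisson tail.
  let e : ℕ → ℝ := fun i => (if componentTime p n t i < (1 + ε) * (2 * n) then C * x else 0)
    + 2 * M * (a n i * n) + ρ ^ n
  have hesum : ∑ i : Fin n, e (i + 1) ≤ (4 + 2 * M) * (C * x) + n * ρ ^ n + C * x *
      (Finset.filter (fun i => componentTime p n t i < (1 + ε) * (2 * n))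
        (Finset.Icc 1 n)).card := by
    rw [sum_fin_succ_eq_sum_Icc n e]
    simp only [e, Finset.sum_add_distrib, ← Finset.mul_sum, ← Finset.sum_mul, Finset.sum_const,
      Nat.card_Icc, nsmul_eq_mul, ← Finset.sum_filter]
    have := mul_le_mul_of_nonneg_left (hF.sum_mul_le hn) (by positivity : 0 ≤ 2 * M)
    rw [Nat.add_sub_cancel]
    linarith
  refine hF.distance_le_of_le_prod hn hp ht (fun y => ?_) ?_
  · refine le_trans (Real.exp_le_exp.2 ?_) (exp_neg_sum_le_prod (e := fun i : Fin n => e (i + 1))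
      ?_ ?_ ?_)
    · linarith
    · intro i
      have := hF.a_nonneg hn (i := i + 1) (by omega) (by omega)
      dsimp only [e]
      split_ifs <;> positivity
    · intro i
      have := mul_le_mul_of_nonneg_left (hF.a_mul_le hn (i := i + 1) (by omega) (by omega))
        (by positivity : 0 ≤ 2 * M)
      dsimp only [e]
      split_ifs <;> linarith
    · intro i
      have hK := (hF.chain n (i + 1) hn (by omega) (by omega)).1
      have ha := hF.a_nonneg hn (i := i + 1) (by omega) (by omega)
      have hca := hF.c_le_a hn hnC (i := i + 1) (by omega) (by omega)
      have hb := (hF.bounds n (i + 1) hn (by omega) (by omega)).2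
      have hs0 := componentTime_nonneg hn hp ht (i := i + 1) (by omega) (by omega)
      have hs1 := hlow (i + 1) (by omega) (by omega)
      have hs2 := hup (i + 1) (by omega) (by omega)
      have h1 : (a n (i + 1) + c n (i + 1)) * componentTime p n t (i + 1)
          ≤ 2 * M * (a n (i + 1) * n) := by
        nlinarith [mul_le_mul_of_nonneg_right hca hs0, mul_le_mul_of_nonneg_left hs2 ha]
      dsimp only [e]
      split_ifs with hs
      · refine le_trans ?_ (le_lacoin_heatKernel_last hn hK hs0 hε hs1 (y i))
        have := mul_le_mul_of_nonneg_right hb hx0.le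
        linarith
      · refine le_trans ?_ (le_lacoin_heatKernel_last_of_le hn hK hs0 hε (not_lt.1 hs) (y i))
        have : ρ ^ (2 * n) ≤ ρ ^ n := pow_le_pow_of_le_one hρ0.le hρ1 (by omega)
        linarith
  -- The summand `4 C n ^ (-β)`, superfluous for the heat kernel, doubles to the `8 C n ^ (-β)`
  -- required here.
  · refine le_trans (Real.exp_le_exp.2 ?_) (hF.exp_le_productDistribution hn hnC ?_)
    · have : 0 ≤ C * x * ((Finset.filter (fun i => componentTime p n t i < (1 + ε) * (2 * n))
        (Finset.Icc 1 n)).card : ℝ) := by positivity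
      linarith
    · linarith

/-- Lower bound for the distance when some coordinate had no time to follow the fast path. -/
theorem le_distance_of_exists (hnC : 2 * C ^ 2 ≤ n) (hx : 8 * C * (n : ℝ) ^ (-β) ≤ 1) {t ε : ℝ}
    (ht : 0 ≤ t) (hε : 0 < ε) (hε1 : ε < 1)
    (hi : ∃ i, 1 ≤ i ∧ i ≤ n ∧ componentTime p n t i ≤ (1 - ε) * n) :
    Real.exp (-(8 * C * (n : ℝ) ^ (-β))) - ((1 - ε) * Real.exp ε) ^ n
      ≤ lacoinProductDistance β a b c π p n t := by
  refine le_trans (sub_le_sub (hF.exp_le_productDistribution hn hnC hx) ?_)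
    (hF.sub_prod_le_distance hn hp ht)
  obtain ⟨i, h1, hin, hs⟩ := hi
  obtain ⟨k, rfl⟩ := Nat.exists_eq_add_of_le' h1
  have hK : ∀ i : Fin n, _ := fun i => (hF.chain n (i + 1) hn (by omega) (by omega)).1
  have hs0 : ∀ i : Fin n, _ :=
    fun i => componentTime_nonneg hn hp ht (i := i + 1) (by omega) (by omega)
  -- One small factor suffices, the others being at most `1`.
  rw [← Finset.mul_prod_erase Finset.univ _ (Finset.mem_univ (⟨k, by omega⟩ : Fin n))]
  refine (mul_le_of_le_one_right (heatKernel_nonneg (hK _) (hs0 _) _ _)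
    (Finset.prod_le_one (fun i _ => heatKernel_nonneg (hK i) (hs0 i) _ _)
      fun i _ => heatKernel_le_one (hK i) (hs0 i) _ _)).trans ?_
  exact lacoin_heatKernel_zero_last_le_pow hn (hK ⟨k, by omega⟩) (hs0 ⟨k, by omega⟩) hε hε1 hs

/-- Lower bound for the distance in terms of the number of coordinates that had no time to follow
the slow path. -/
theorem le_distance (hnC : 2 * C ^ 2 ≤ n) (hx : 8 * C * (n : ℝ) ^ (-β) ≤ 1) {t ε : ℝ}
    (ht : 0 ≤ t) (hε : 0 < ε) (hε1 : ε < 1)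
    (hsmall : 2 * (C * (n : ℝ) ^ (-β)) + ((1 - ε) * Real.exp ε) ^ (2 * n) ≤ 1 / 2) :
    Real.exp (-(8 * C * (n : ℝ) ^ (-β))) - Real.exp (-(C⁻¹ * (n : ℝ) ^ (-β) / 2 *
      (Finset.filter (fun i => componentTime p n t i ≤ (1 - ε) * (2 * n))
        (Finset.Icc 1 n)).card)) ≤ lacoinProductDistance β a b c π p n t := by
  set x := (n : ℝ) ^ (-β) with hxdef
  have hC := hF.one_lt
  have hx0 : 0 < x := Real.rpow_pos_of_pos (by positivity) _
  refine le_trans (sub_le_sub (hF.exp_le_productDistribution hn hnC hx) ?_)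
    (hF.sub_prod_le_distance hn hp ht)
  let e : ℕ → ℝ := fun i =>
    if componentTime p n t i ≤ (1 - ε) * (2 * n) then C⁻¹ * x / 2 else 0
  have hesum : ∑ i : Fin n, e (i + 1) = C⁻¹ * x / 2 *
      (Finset.filter (fun i => componentTime p n t i ≤ (1 - ε) * (2 * n))
        (Finset.Icc 1 n)).card := by
    rw [sum_fin_succ_eq_sum_Icc n e, ← Finset.sum_filter, Finset.sum_const, nsmul_eq_mul, mul_comm]
  rw [← hesum]
  have hK : ∀ i : Fin n, _ := fun i => (hF.chain n (i + 1) hn (by omega) (by omega)).1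
  have hs0 : ∀ i : Fin n, _ :=
    fun i => componentTime_nonneg hn hp ht (i := i + 1) (by omega) (by omega)
  refine prod_le_exp_neg_sum (fun i => heatKernel_nonneg (hK i) (hs0 i) _ _) fun i => ?_
  dsimp only [e]
  split_ifs with hs
  · refine (lacoin_heatKernel_zero_last_le hn (hK i) (hs0 i) hε hε1 hs).trans ?_
    have hb := (hF.bounds n (i + 1) hn (by omega) (by omega)).1
    have ha := hF.a_nonneg hn (i := i + 1) (by omega) (by omega)
    have ha2 := hF.a_mul_le hn (i := i + 1) (by omega) (by omega)
    have hs2 : componentTime p n t (i + 1) ≤ 2 * n :=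
      hs.trans (mul_le_of_le_one_left (by positivity) (by linarith))
    have h1 := mul_le_mul_of_nonneg_left hs2 ha
    -- As `a s ≤ 2 a n ≤ 2 C n ^ (-β)`, half of the slow-path probability survives; hence the `/ 2`
    -- in `e`.
    have h2 : 1 / 2 ≤ 1 - a n (i + 1) * componentTime p n t (i + 1)
        - ((1 - ε) * Real.exp ε) ^ (2 * n) := by linarith
    have h3 := mul_le_mul (mul_le_mul_of_nonneg_right hb hx0.le) h2 (by norm_num)
      (mul_nonneg ((inv_nonneg.2 (by linarith)).trans hb) hx0.le)
    linarith
  · simpa using heatKernel_le_one (hK i) (hs0 i) _ _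

end

end IsLacoinFamily

end LacoinFamilies

/-! ### Limits of the distance at times `θ Q n ^ 2`, in terms of counts of weights. -/

section Asymptotics

open Matrix

/-- Weights between `1` and `2` whose sum is asymptotic to `Q n`. -/
structure IsModerateWeight (p : ℕ → ℕ → ℝ) (Q : ℝ) : Prop where
  pos : 0 < Q
  one_le : ∀ n i : ℕ, 2 ≤ n → 1 ≤ i → i ≤ n → 1 ≤ p n i
  le_two : ∀ n i : ℕ, 2 ≤ n → 1 ≤ i → i ≤ n → p n i ≤ 2
  tendsto : Tendsto (fun n : ℕ => (∑ k ∈ Finset.Icc 1 n, p n k) / n) atTop (𝓝 Q)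

namespace IsModerateWeight

variable {p : ℕ → ℕ → ℝ} {Q : ℝ} (hW : IsModerateWeight p Q)

include hW

theorem weight_pos {n : ℕ} (hn : 2 ≤ n) (i : ℕ) (h1 : 1 ≤ i) (hi : i ≤ n) : 0 < p n i :=
  zero_lt_one.trans_le (hW.one_le n i hn h1 hi)

theorem tendsto_inv : Tendsto (fun n : ℕ => Q * n / ∑ k ∈ Finset.Icc 1 n, p n k) atTop (𝓝 1) := by
  have h := (hW.tendsto.inv₀ hW.pos.ne').const_mul Q
  rw [mul_inv_cancel₀ hW.pos.ne'] at h
  refine h.congr fun n => ?_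
  rw [inv_div, mul_div_assoc]

omit hW in
theorem componentTime_eq (θ : ℝ) (n i : ℕ) : componentTime p n (θ * Q * (n : ℝ) ^ 2) i
    = θ * (Q * n / ∑ k ∈ Finset.Icc 1 n, p n k) * p n i * n := by
  unfold componentTime
  ring

/-- The factor `Q n / q_n → 1` does not depend on `i`, so the gap between `θ` and `u` absorbs it
uniformly. -/
theorem eventually_componentTime_le {θ u : ℝ} (hu : θ < u) :
    ∀ᶠ n : ℕ in atTop, ∀ i, 1 ≤ i → i ≤ n →
      componentTime p n (θ * Q * (n : ℝ) ^ 2) i ≤ u * p n i * n := by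
  have h := (hW.tendsto_inv.const_mul θ).eventually_le_const (by rwa [mul_one])
  filter_upwards [h, eventually_ge_atTop 2] with n hn h2 i h1 hi
  rw [componentTime_eq]
  have := (hW.weight_pos h2 i h1 hi).le
  gcongr

theorem eventually_le_componentTime {θ u : ℝ} (hu : u < θ) :
    ∀ᶠ n : ℕ in atTop, ∀ i, 1 ≤ i → i ≤ n →
      u * p n i * n ≤ componentTime p n (θ * Q * (n : ℝ) ^ 2) i := by
  have h := (hW.tendsto_inv.const_mul θ).eventually_const_le (by rwa [mul_one])
  filter_upwards [h, eventually_ge_atTop 2] with n hn h2 i h1 hi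
  rw [componentTime_eq]
  have := (hW.weight_pos h2 i h1 hi).le
  gcongr

end IsModerateWeight

theorem add_one_mul_exp_neg_lt_one {x : ℝ} (hx : x ≠ 0) : (1 + x) * Real.exp (-x) < 1 := by
  rw [Real.exp_neg, ← div_eq_mul_inv, div_lt_one (Real.exp_pos _), add_comm]
  exact Real.add_one_lt_exp hx

theorem tendsto_natCast_rpow_neg {β : ℝ} (hβ : 0 < β) :
    Tendsto (fun n : ℕ => (n : ℝ) ^ (-β)) atTop (𝓝 0) :=
  (tendsto_rpow_neg_atTop hβ).comp tendsto_natCast_atTop_atTop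

theorem lacoinProductDistance_nonneg (β : ℝ) (a b c : ℕ → ℕ → ℝ)
    (π : ∀ n : ℕ, ℕ → Fin (2 * n + 1) → ℝ) (p : ℕ → ℕ → ℝ) (n : ℕ) (t : ℝ) :
    0 ≤ lacoinProductDistance β a b c π p n t := by
  have h := le_tvDistance
    (productKernel (fun i : Fin n => p n (i + 1) / ∑ k ∈ Finset.Icc 1 n, p n k)
      (fun i : Fin n => lacoinKernel β n (a n (i + 1)) (b n (i + 1)) (c n (i + 1))))
    (productDistribution (fun i : Fin n => π n (i + 1))) t (fun _ => 0) ∅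
  rw [Finset.sum_empty, Finset.sum_empty, sub_zero] at h
  exact h

namespace IsLacoinFamily

variable {β : ℝ} {a b c : ℕ → ℕ → ℝ} {π : ∀ n : ℕ, ℕ → Fin (2 * n + 1) → ℝ} {C : ℝ}
  (hF : IsLacoinFamily β a b c π C) {p : ℕ → ℕ → ℝ} {Q : ℝ} (hW : IsModerateWeight p Q)

include hF hW

theorem eventually_distance_le_one {t : ℕ → ℝ} (ht : ∀ n, 0 ≤ t n) :
    ∀ᶠ n : ℕ in atTop, lacoinProductDistance β a b c π p n (t n) ≤ 1 := by
  filter_upwards [eventually_ge_atTop 2] with n hn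
  have hp : ∀ i, 1 ≤ i → i ≤ n → 0 < p n i := hW.weight_pos hn
  have h := hF.distance_le_of_le_prod hn hp (ht n) (P := 0)
    (fun x => Finset.prod_nonneg fun i _ =>
      heatKernel_nonneg (hF.chain n (i + 1) hn (by omega) (by omega)).1
        (componentTime_nonneg hn hp (ht n) (by omega) (by omega)) _ _)
    ((hF.productDistribution_mem hn).1 _)
  simpa using h

/-- As weights are at least `1`, `θ > 1` leaves every coordinate time for the fast path; `γ * θ > 2`
leaves those of weight at least `γ` time for the slow one. -/
theorem exists_distance_le {θ γ : ℝ} (hθ : 1 < θ) (hγ : 2 < γ * θ) :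
    ∃ η : ℕ → ℝ, Tendsto η atTop (𝓝 0) ∧ ∀ᶠ n : ℕ in atTop,
      lacoinProductDistance β a b c π p n (θ * Q * (n : ℝ) ^ 2) ≤ 1 - Real.exp (-(2 * (η n
        + C * ((n : ℝ) ^ (-β) *
          (Finset.filter (fun i => p n i < γ) (Finset.Icc 1 n)).card)))) := by
  have hγ0 : 0 < γ := by
    by_contra h
    nlinarith
  obtain ⟨u, hu1, huθ⟩ : ∃ u, max 1 (2 / γ) < u ∧ u < θ :=
    exists_between (max_lt hθ (by rwa [div_lt_iff₀ hγ0, mul_comm]))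
  have hu := max_lt_iff.1 hu1
  have hu2 : 2 < γ * u := by
    have := hu.2
    rwa [div_lt_iff₀ hγ0, mul_comm] at this
  obtain ⟨ε, hε, hεu⟩ : ∃ ε, 0 < ε ∧ ε < min (u - 1) (γ * u / 2 - 1) :=
    exists_between (lt_min (by linarith) (by linarith))
  have hε' := lt_min_iff.1 hεu
  set ρ := (1 + ε) * Real.exp (-ε) with hρ
  have hρ0 : 0 ≤ ρ := by positivity
  have hρ1 : ρ < 1 := add_one_mul_exp_neg_lt_one hε.ne'
  have hx := tendsto_natCast_rpow_neg hF.beta_pos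
  have hnρ := tendsto_self_mul_const_pow_of_lt_one hρ0 hρ1
  have hη : ∀ D : ℝ, Tendsto (fun n : ℕ => D * (C * (n : ℝ) ^ (-β)) + n * ρ ^ n) atTop (𝓝 0) := by
    intro D
    simpa using ((hx.const_mul C).const_mul D).add hnρ
  -- Component times are eventually at most `2 θ p_i n`, and weights are at most `2`.
  set M := 4 * θ with hM
  refine ⟨_, hη (4 + 2 * M), ?_⟩
  filter_upwards [eventually_ge_atTop 2, tendsto_natCast_atTop_atTop.eventually_ge_atTop (2 * C ^ 2),
    hW.eventually_le_componentTime huθ,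
    hW.eventually_componentTime_le (by linarith : θ < 2 * θ),
    (hη (5 + 2 * M)).eventually_le_const (by norm_num : (0 : ℝ) < 1 / 2)] with
    n hn hnC hlow hup hsmall
  have hC := hF.one_lt
  have hQ := hW.pos
  have hn0 : (0 : ℝ) < n := by positivity
  have h := hF.distance_le hn (hW.weight_pos hn) hnC
    (t := θ * Q * (n : ℝ) ^ 2) (ε := ε) (M := M) (by positivity) hε (by positivity) ?_ ?_ hsmall
  · refine h.trans (sub_le_sub_left (Real.exp_le_exp.2 ?_) 1)
    rw [neg_le_neg_iff, mul_assoc C]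
    suffices hsub : Finset.filter (fun i => componentTime p n (θ * Q * (n : ℝ) ^ 2) i
        < (1 + ε) * (2 * n)) (Finset.Icc 1 n) ⊆
        Finset.filter (fun i => p n i < γ) (Finset.Icc 1 n) by
      have := Finset.card_le_card hsub
      gcongr
    refine Finset.monotone_filter_right _ fun i hi hs => ?_
    rw [Finset.mem_Icc] at hi
    by_contra hlt
    have h1 := hlow i hi.1 hi.2
    have h2 : u * γ * n ≤ u * p n i * n := by
      have : 0 < u := by linarith
      gcongr
      exact not_lt.1 hlt
    nlinarith
  · intro i h1 hi
    refine le_trans ?_ (hlow i h1 hi)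
    have := hW.one_le n i hn h1 hi
    have : 1 + ε ≤ u * p n i := by nlinarith
    gcongr
  · intro i h1 hi
    refine (hup i h1 hi).trans ?_
    have := hW.le_two n i hn h1 hi
    have : 2 * θ * p n i ≤ M := by nlinarith
    gcongr

theorem tendsto_distance_zero {θ γ : ℝ} (hθ : 1 < θ) (hγ : 2 < γ * θ)
    (hcard : Tendsto (fun n : ℕ => (n : ℝ) ^ (-β) *
      (Finset.filter (fun i => p n i < γ) (Finset.Icc 1 n)).card) atTop (𝓝 0)) :
    Tendsto (fun n : ℕ => lacoinProductDistance β a b c π p n (θ * Q * (n : ℝ) ^ 2)) atTop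
      (𝓝 0) := by
  obtain ⟨η, hη, h⟩ := hF.exists_distance_le hW hθ hγ
  refine tendsto_of_tendsto_of_tendsto_of_le_of_le' tendsto_const_nhds ?_
    (Eventually.of_forall fun n => lacoinProductDistance_nonneg _ _ _ _ _ _ _ _) h
  have h1 := (((hη.add (hcard.const_mul C)).const_mul 2).neg.rexp).const_sub 1
  simpa using h1

theorem eventually_distance_le_of_card_le {θ γ D : ℝ} (hθ : 1 < θ) (hγ : 2 < γ * θ)
    (hcard : ∀ᶠ n : ℕ in atTop, (n : ℝ) ^ (-β) *
      (Finset.filter (fun i => p n i < γ) (Finset.Icc 1 n)).card ≤ D) :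
    ∃ δ > 0, ∀ᶠ n : ℕ in atTop,
      lacoinProductDistance β a b c π p n (θ * Q * (n : ℝ) ^ 2) ≤ 1 - δ := by
  obtain ⟨η, hη, h⟩ := hF.exists_distance_le hW hθ hγ
  refine ⟨Real.exp (-(2 * (1 + C * D))), Real.exp_pos _, ?_⟩
  filter_upwards [h, hη.eventually_le_const zero_lt_one, hcard] with n h1 h2 h3
  refine h1.trans (sub_le_sub_left (Real.exp_le_exp.2 ?_) 1)
  have := hF.one_lt
  rw [neg_le_neg_iff]
  gcongr

/-- A coordinate of weight at most `γ` has run for about `γ θ n < n` at most, too short even for the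
fast path. -/
theorem tendsto_distance_one_of_exists {θ γ : ℝ} (hθ : 0 < θ) (hγ : γ * θ < 1)
    (hex : ∀ᶠ n : ℕ in atTop, ∃ i, 1 ≤ i ∧ i ≤ n ∧ p n i ≤ γ) :
    Tendsto (fun n : ℕ => lacoinProductDistance β a b c π p n (θ * Q * (n : ℝ) ^ 2)) atTop
      (𝓝 1) := by
  have hγ0 : 0 < γ := by
    obtain ⟨n, ⟨i, h1, hi, hp⟩, hn⟩ := (hex.and (eventually_ge_atTop 2)).exists
    exact (hW.weight_pos hn i h1 hi).trans_le hp
  obtain ⟨u, huθ, hu1⟩ : ∃ u, θ < u ∧ u < 1 / γ :=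
    exists_between (by rwa [lt_div_iff₀ hγ0, mul_comm])
  rw [lt_div_iff₀ hγ0] at hu1
  obtain ⟨ε, hε, hε1⟩ : ∃ ε, 0 < ε ∧ ε < 1 - u * γ := exists_between (by linarith)
  have huγ : 0 < u * γ := mul_pos (hθ.trans huθ) hγ0
  have hρ1 : (1 - ε) * Real.exp ε < 1 := by
    simpa [← sub_eq_add_neg] using add_one_mul_exp_neg_lt_one (neg_ne_zero.2 hε.ne')
  have hx := tendsto_natCast_rpow_neg hF.beta_pos
  have hρ := tendsto_pow_atTop_nhds_zero_of_lt_one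
    (mul_nonneg (by linarith : 0 ≤ 1 - ε) (Real.exp_pos ε).le) hρ1
  have hlow : Tendsto (fun n : ℕ => Real.exp (-(8 * C * (n : ℝ) ^ (-β)))
      - ((1 - ε) * Real.exp ε) ^ n) atTop (𝓝 1) := by
    simpa using ((hx.const_mul (8 * C)).neg.rexp).sub hρ
  refine tendsto_of_tendsto_of_tendsto_of_le_of_le' hlow tendsto_const_nhds ?_
    (hF.eventually_distance_le_one hW fun n => ?_)
  · filter_upwards [eventually_ge_atTop 2, tendsto_natCast_atTop_atTop.eventually_ge_atTop (2 * C ^ 2), hex,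
      hW.eventually_componentTime_le huθ,
      (hx.const_mul (8 * C)).eventually_le_const (by simp : 8 * C * 0 < 1)] with
      n hn hnC ⟨i, h1, hi, hp⟩ hup hx8
    have hQ := hW.pos
    refine hF.le_distance_of_exists hn (hW.weight_pos hn) hnC hx8 (by positivity) hε
      (by linarith) ⟨i, h1, hi, (hup i h1 hi).trans ?_⟩
    have : u * p n i ≤ 1 - ε := by nlinarith
    gcongr
  · have := hW.pos
    positivity

/-- Coordinates of weight at most `γ` have run for less than `2n`, so each may still be on the slow
path. -/
theorem exists_le_distance {θ γ : ℝ} (hθ : 0 < θ) (hγ0 : 0 < γ) (hγ : γ * θ < 2) :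
    ∃ η : ℕ → ℝ, Tendsto η atTop (𝓝 1) ∧ ∀ᶠ n : ℕ in atTop,
      η n - Real.exp (-(C⁻¹ / 2 * ((n : ℝ) ^ (-β) *
          (Finset.filter (fun i => p n i ≤ γ) (Finset.Icc 1 n)).card)))
        ≤ lacoinProductDistance β a b c π p n (θ * Q * (n : ℝ) ^ 2) := by
  obtain ⟨u, huθ, hu1⟩ : ∃ u, θ < u ∧ u < 2 / γ :=
    exists_between (by rwa [lt_div_iff₀ hγ0, mul_comm])
  rw [lt_div_iff₀ hγ0] at hu1
  obtain ⟨ε, hε, hε1⟩ : ∃ ε, 0 < ε ∧ ε < 1 - u * γ / 2 := exists_between (by linarith)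
  have huγ : 0 < u * γ := mul_pos (hθ.trans huθ) hγ0
  have hρ1 : (1 - ε) * Real.exp ε < 1 := by
    simpa [← sub_eq_add_neg] using add_one_mul_exp_neg_lt_one (neg_ne_zero.2 hε.ne')
  have hx := tendsto_natCast_rpow_neg hF.beta_pos
  have hρ := tendsto_pow_atTop_nhds_zero_of_lt_one
    (mul_nonneg (by linarith : 0 ≤ 1 - ε) (Real.exp_pos ε).le) hρ1
  have hρ2 : Tendsto (fun n : ℕ => 2 * (C * (n : ℝ) ^ (-β)) + ((1 - ε) * Real.exp ε) ^ (2 * n))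
      atTop (𝓝 0) := by
    have := hρ.comp (tendsto_id.const_mul_atTop' (by norm_num : 0 < 2))
    simpa using ((hx.const_mul C).const_mul 2).add this
  refine ⟨fun n => Real.exp (-(8 * C * (n : ℝ) ^ (-β))), ?_, ?_⟩
  · simpa using (hx.const_mul (8 * C)).neg.rexp
  filter_upwards [eventually_ge_atTop 2, tendsto_natCast_atTop_atTop.eventually_ge_atTop (2 * C ^ 2),
    hW.eventually_componentTime_le huθ,
    (hx.const_mul (8 * C)).eventually_le_const (by simp : 8 * C * 0 < 1),
    hρ2.eventually_le_const (by norm_num : (0 : ℝ) < 1 / 2)] with n hn hnC hup hx8 hsmall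
  have hQ := hW.pos
  have hC := hF.one_lt
  have h := hF.le_distance hn (hW.weight_pos hn) hnC hx8 (t := θ * Q * (n : ℝ) ^ 2)
    (by positivity) hε (by linarith) hsmall
  refine le_trans (sub_le_sub_left (Real.exp_le_exp.2 ?_) _) h
  rw [neg_le_neg_iff, ← mul_assoc, div_mul_eq_mul_div]
  suffices hsub : Finset.filter (fun i => p n i ≤ γ) (Finset.Icc 1 n) ⊆
      Finset.filter (fun i => componentTime p n (θ * Q * (n : ℝ) ^ 2) i ≤ (1 - ε) * (2 * n))
        (Finset.Icc 1 n) by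
    have := Finset.card_le_card hsub
    gcongr
  refine Finset.monotone_filter_right _ fun i hi hp => ?_
  rw [Finset.mem_Icc] at hi
  refine (hup i hi.1 hi.2).trans ?_
  rw [← mul_assoc]
  have : u * p n i ≤ (1 - ε) * 2 := by nlinarith
  gcongr

theorem tendsto_distance_one {θ γ : ℝ} (hθ : 0 < θ) (hγ0 : 0 < γ) (hγ : γ * θ < 2)
    (hcard : Tendsto (fun n : ℕ => (n : ℝ) ^ (-β) *
      (Finset.filter (fun i => p n i ≤ γ) (Finset.Icc 1 n)).card) atTop atTop) :
    Tendsto (fun n : ℕ => lacoinProductDistance β a b c π p n (θ * Q * (n : ℝ) ^ 2)) atTop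
      (𝓝 1) := by
  obtain ⟨η, hη, h⟩ := hF.exists_le_distance hW hθ hγ0 hγ
  have hC := hF.one_lt
  refine tendsto_of_tendsto_of_tendsto_of_le_of_le' ?_ tendsto_const_nhds h
    (hF.eventually_distance_le_one hW fun n => ?_)
  · have h1 := Real.tendsto_exp_neg_atTop_nhds_zero.comp
      (hcard.const_mul_atTop (by positivity : 0 < C⁻¹ / 2))
    simpa using hη.sub h1
  · have := hW.pos
    positivity

theorem eventually_le_distance_of_le_card {θ γ D : ℝ} (hθ : 0 < θ) (hγ0 : 0 < γ) (hγ : γ * θ < 2)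
    (hD : 0 < D) (hcard : ∀ᶠ n : ℕ in atTop, D ≤ (n : ℝ) ^ (-β) *
      (Finset.filter (fun i => p n i ≤ γ) (Finset.Icc 1 n)).card) :
    ∃ δ > 0, ∀ᶠ n : ℕ in atTop,
      δ ≤ lacoinProductDistance β a b c π p n (θ * Q * (n : ℝ) ^ 2) := by
  obtain ⟨η, hη, h⟩ := hF.exists_le_distance hW hθ hγ0 hγ
  have hC := hF.one_lt
  have hlt : Real.exp (-(C⁻¹ / 2 * D)) < 1 := by
    rw [Real.exp_lt_one_iff]
    have : 0 < C⁻¹ / 2 * D := by positivity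
    linarith
  refine ⟨(1 - Real.exp (-(C⁻¹ / 2 * D))) / 2, by linarith, ?_⟩
  filter_upwards [h, hη.eventually_const_le
    (by linarith : (1 + Real.exp (-(C⁻¹ / 2 * D))) / 2 < 1), hcard] with n h1 h2 h3
  have h4 : Real.exp (-(C⁻¹ / 2 * ((n : ℝ) ^ (-β) *
      (Finset.filter (fun i => p n i ≤ γ) (Finset.Icc 1 n)).card))) ≤
      Real.exp (-(C⁻¹ / 2 * D)) := by
    rw [Real.exp_le_exp, neg_le_neg_iff]
    gcongr
  linarith

end IsLacoinFamily

end Asymptotics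

/-! ### Weights with a positive proportion near the minimum. -/

section Cutoff

theorem natCast_rpow_neg_mul_self (β : ℝ) {n : ℕ} (hn : n ≠ 0) :
    (n : ℝ) ^ (-β) * n = (n : ℝ) ^ (1 - β) := by
  have h : (0 : ℝ) < n := by positivity
  rw [sub_eq_neg_add, Real.rpow_add_one h.ne']

theorem card_filter_Icc_le (n : ℕ) (P : ℕ → Prop) [DecidablePred P] :
    (Finset.filter P (Finset.Icc 1 n)).card ≤ n :=
  (Finset.card_filter_le _ P).trans (by simp)

namespace IsLacoinFamily

variable {β : ℝ} {a b c : ℕ → ℕ → ℝ} {π : ∀ n : ℕ, ℕ → Fin (2 * n + 1) → ℝ} {C : ℝ}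
  (hF : IsLacoinFamily β a b c π C) {p : ℕ → ℕ → ℝ} {Q : ℝ} (hW : IsModerateWeight p Q)

include hF hW

omit hF in
theorem eventually_time_pos {κ : ℝ} (hκ : 0 < κ) :
    ∀ᶠ n : ℕ in atTop, 0 < κ * Q * (n : ℝ) ^ 2 := by
  filter_upwards [eventually_ge_atTop 1] with n hn
  have := hW.pos
  have : (0 : ℝ) < n := by exact_mod_cast hn
  positivity

theorem isCutoffTime_of_lt_one
    (hbulk : ∀ γ : ℝ, 1 < γ → ∃ ρ : ℝ, 0 < ρ ∧ ∀ᶠ n : ℕ in atTop,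
      ρ * n ≤ (Finset.filter (fun i => p n i ≤ γ) (Finset.Icc 1 n)).card) (hβ : β < 1) :
    IsCutoffTime (lacoinProductDistance β a b c π p) (fun n => 2 * Q * (n : ℝ) ^ 2) := by
  refine ⟨eventually_time_pos hW two_pos, fun r hr => ?_, fun r hr0 hr1 => ?_⟩
  -- No weight is below `γ = 1`, so the count is zero.
  · have h := hF.tendsto_distance_zero hW (θ := r * 2) (γ := 1) (by linarith) (by linarith) ?_
    · simpa only [mul_assoc] using h
    · refine tendsto_const_nhds.congr' ?_
      filter_upwards [eventually_ge_atTop 2] with n hn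
      rw [Finset.filter_false_of_mem, Finset.card_empty, Nat.cast_zero, mul_zero]
      intro i hi
      rw [Finset.mem_Icc] at hi
      exact not_lt.2 (hW.one_le n i hn hi.1 hi.2)
  · obtain ⟨γ, hγ1, hγ⟩ : ∃ γ, 1 < γ ∧ γ < 1 / r :=
      exists_between (by rwa [lt_div_iff₀ hr0, one_mul])
    rw [lt_div_iff₀ hr0] at hγ
    have h := hF.tendsto_distance_one hW (θ := r * 2) (γ := γ) (by linarith) (by linarith)
      (by linarith) ?_
    · simpa only [mul_assoc] using h
    · obtain ⟨ρ, hρ, hcard⟩ := hbulk γ hγ1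
      have hlim : Tendsto (fun n : ℕ => ρ * (n : ℝ) ^ (1 - β)) atTop atTop :=
        ((tendsto_rpow_atTop (by linarith)).comp tendsto_natCast_atTop_atTop).const_mul_atTop hρ
      refine tendsto_atTop_mono' _ ?_ hlim
      filter_upwards [hcard, eventually_ne_atTop 0] with n hn hn0
      rw [← natCast_rpow_neg_mul_self β hn0, mul_left_comm]
      gcongr

theorem isCutoffTime_of_one_lt
    (hbulk : ∀ γ : ℝ, 1 < γ → ∃ ρ : ℝ, 0 < ρ ∧ ∀ᶠ n : ℕ in atTop,
      ρ * n ≤ (Finset.filter (fun i => p n i ≤ γ) (Finset.Icc 1 n)).card) (hβ : 1 < β) :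
    IsCutoffTime (lacoinProductDistance β a b c π p) (fun n => Q * (n : ℝ) ^ 2) := by
  refine ⟨by simpa using eventually_time_pos hW one_pos, fun r hr => ?_, fun r hr0 hr1 => ?_⟩
  -- The trivial count `n` is enough, since `n ^ (1 - β) → 0`.
  · have h := hF.tendsto_distance_zero hW (θ := r) (γ := 2) hr (by linarith) ?_
    · simpa only [mul_assoc] using h
    · have hlim : Tendsto (fun n : ℕ => (n : ℝ) ^ (1 - β)) atTop (𝓝 0) := by
        simpa using tendsto_natCast_rpow_neg (by linarith : 0 < β - 1)
      refine tendsto_of_tendsto_of_tendsto_of_le_of_le' tendsto_const_nhds hlim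
        (Eventually.of_forall fun n => by positivity) ?_
      filter_upwards [eventually_ne_atTop 0] with n hn0
      rw [← natCast_rpow_neg_mul_self β hn0]
      gcongr
      exact card_filter_Icc_le n (fun i => p n i < 2)
  · obtain ⟨γ, hγ1, hγ⟩ : ∃ γ, 1 < γ ∧ γ < 1 / r :=
      exists_between (by rwa [lt_div_iff₀ hr0, one_mul])
    rw [lt_div_iff₀ hr0] at hγ
    have h := hF.tendsto_distance_one_of_exists hW (θ := r) (γ := γ) hr0 hγ ?_
    · simpa only [mul_assoc] using h
    · obtain ⟨ρ, hρ, hcard⟩ := hbulk γ hγ1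
      filter_upwards [hcard, eventually_ge_atTop 1] with n hn hn1
      have hpos : (0 : ℝ) < (Finset.filter (fun i => p n i ≤ γ) (Finset.Icc 1 n)).card :=
        lt_of_lt_of_le (mul_pos hρ (by exact_mod_cast hn1)) hn
      obtain ⟨i, hi⟩ := Finset.card_pos.1 (Nat.cast_pos.1 hpos)
      rw [Finset.mem_filter, Finset.mem_Icc] at hi
      exact ⟨i, hi.1.1, hi.1.2, hi.2⟩

theorem not_hasCutoff_of_eq_one
    (hbulk : ∀ γ : ℝ, 1 < γ → ∃ ρ : ℝ, 0 < ρ ∧ ∀ᶠ n : ℕ in atTop,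
      ρ * n ≤ (Finset.filter (fun i => p n i ≤ γ) (Finset.Icc 1 n)).card) (hβ : β = 1) :
    ¬ HasCutoff (lacoinProductDistance β a b c π p) := by
  rintro ⟨T, hT0, hT1, hT2⟩
  have hx : ∀ n : ℕ, n ≠ 0 → (n : ℝ) ^ (-β) * n = 1 := fun n hn => by
    rw [natCast_rpow_neg_mul_self β hn, hβ, sub_self, Real.rpow_zero]
  obtain ⟨δ₁, hδ₁, h1⟩ := hF.eventually_distance_le_of_card_le hW (θ := 6 / 5) (γ := 2) (D := 1)
    (by norm_num) (by norm_num) (by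
      filter_upwards [eventually_ne_atTop 0] with n hn
      rw [← hx n hn]
      gcongr
      exact card_filter_Icc_le n (fun i => p n i < 2))
  obtain ⟨ρ, hρ, hcard⟩ := hbulk (11 / 10) (by norm_num)
  obtain ⟨δ₂, hδ₂, h2⟩ := hF.eventually_le_distance_of_le_card hW (θ := 9 / 5) (γ := 11 / 10)
    (D := ρ) (by norm_num) (by norm_num) (by norm_num) hρ (by
      filter_upwards [hcard, eventually_ne_atTop 0] with n h hn
      calc ρ = (n : ℝ) ^ (-β) * (ρ * n) := by rw [mul_left_comm, hx n hn, mul_one]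
        _ ≤ _ := by gcongr)
  have e1 := (hT1 (6 / 5) (by norm_num)).eventually_lt_const hδ₂
  have e2 := (hT2 (4 / 5) (by norm_num) (by norm_num)).eventually_const_lt
    (by linarith : 1 - δ₁ < 1)
  obtain ⟨n, h1, h2, e1, e2, hn⟩ :=
    (h1.and (h2.and (e1.and (e2.and (eventually_ge_atTop 2))))).exists
  -- The midpoint `3/2` of the window is compatible with both test times: `6/5 * 3/2 = 9/5`, where
  -- the distance is at least `δ₂`, and `4/5 * 3/2 = 6/5`, where it is at most `1 - δ₁`.
  rcases le_or_gt (T n) (3 / 2 * Q * (n : ℝ) ^ 2) with h | h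
  · have := hF.distance_antitone hn (hW.weight_pos hn)
      (by linarith : 6 / 5 * T n ≤ 9 / 5 * Q * (n : ℝ) ^ 2)
    linarith
  · have := hF.distance_antitone hn (hW.weight_pos hn)
      (by linarith : 6 / 5 * Q * (n : ℝ) ^ 2 ≤ 4 / 5 * T n)
    linarith

/-- If a positive proportion of the weights is close to the smallest one, then there is a cutoff
exactly when `β ≠ 1`. -/
theorem hasCutoff_iff
    (hbulk : ∀ γ : ℝ, 1 < γ → ∃ ρ : ℝ, 0 < ρ ∧ ∀ᶠ n : ℕ in atTop,
      ρ * n ≤ (Finset.filter (fun i => p n i ≤ γ) (Finset.Icc 1 n)).card) :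
    HasCutoff (lacoinProductDistance β a b c π p) ↔ β ≠ 1 := by
  refine ⟨fun h hβ => hF.not_hasCutoff_of_eq_one hW hbulk hβ h, fun hβ => ?_⟩
  rcases hβ.lt_or_gt with h | h
  · exact ⟨_, hF.isCutoffTime_of_lt_one hW hbulk h⟩
  · exact ⟨_, hF.isCutoffTime_of_one_lt hW hbulk h⟩

end IsLacoinFamily

end Cutoff

/-! ### The three families of weights. -/

section Weights

theorem sum_two_zpow_le (n : ℕ) : ∑ k ∈ Finset.Icc 1 n, (2 : ℝ) ^ ((k : ℤ) - (n : ℤ)) ≤ 2 := by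
  induction n with
  | zero => simp
  | succ n ih =>
    rw [Finset.sum_Icc_succ_top (by omega)]
    have h : ∀ k ∈ Finset.Icc 1 n, (2 : ℝ) ^ ((k : ℤ) - ((n + 1 : ℕ) : ℤ))
        = (2 : ℝ) ^ ((k : ℤ) - (n : ℤ)) * (1 / 2) := by
      intro k _
      rw [show (k : ℤ) - ((n + 1 : ℕ) : ℤ) = ((k : ℤ) - n) - 1 by push_cast; ring,
        zpow_sub_one₀ two_ne_zero, one_div]
    rw [Finset.sum_congr rfl h, ← Finset.sum_mul, sub_self, zpow_zero]
    linarith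

theorem isModerateWeight_zpow :
    IsModerateWeight (fun n i => 1 + (2 : ℝ) ^ ((i : ℤ) - (n : ℤ))) 1 := by
  refine ⟨one_pos, fun n i _ _ _ => ?_, fun n i _ _ hi => ?_, ?_⟩
  · have : (0 : ℝ) < (2 : ℝ) ^ ((i : ℤ) - (n : ℤ)) := by positivity
    linarith
  · have : (2 : ℝ) ^ ((i : ℤ) - (n : ℤ)) ≤ 1 := zpow_le_one_of_nonpos₀ one_le_two (by omega)
    linarith
  · have hlim : Tendsto (fun n : ℕ => 1 + 2 / (n : ℝ)) atTop (𝓝 1) := by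
      simpa using (tendsto_const_div_atTop_nhds_zero_nat (2 : ℝ)).const_add 1
    refine tendsto_of_tendsto_of_tendsto_of_le_of_le' tendsto_const_nhds hlim ?_ ?_
    all_goals
      filter_upwards [eventually_gt_atTop 0] with n hn
      have hn0 : (0 : ℝ) < n := by exact_mod_cast hn
      rw [Finset.sum_add_distrib, Finset.sum_const, Nat.card_Icc, Nat.add_sub_cancel, nsmul_eq_mul,
        mul_one]
    · rw [le_div_iff₀ hn0, one_mul, le_add_iff_nonneg_right]
      positivity
    · rw [div_le_iff₀ hn0, add_mul, div_mul_cancel₀ _ hn0.ne', one_mul]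
      linarith [sum_two_zpow_le n]

theorem natCast_le_card_filter {n m : ℕ} {P : ℕ → Prop} [DecidablePred P] (hm : m ≤ n)
    (h : ∀ i, 1 ≤ i → i ≤ m → P i) :
    (m : ℝ) ≤ (Finset.filter P (Finset.Icc 1 n)).card := by
  have hsub : Finset.Icc 1 m ⊆ Finset.filter P (Finset.Icc 1 n) := by
    intro i hi
    rw [Finset.mem_Icc] at hi
    exact Finset.mem_filter.2 ⟨Finset.mem_Icc.2 ⟨hi.1, hi.2.trans hm⟩, h i hi.1 hi.2⟩
  have := Finset.card_le_card hsub
  rw [Nat.card_Icc, Nat.add_sub_cancel] at this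
  exact_mod_cast this

/-- All but the last `k` weights qualify once `2 ^ (-k) < γ - 1`. -/
theorem bulk_zpow (γ : ℝ) (hγ : 1 < γ) : ∃ ρ : ℝ, 0 < ρ ∧ ∀ᶠ n : ℕ in atTop,
    ρ * n ≤ (Finset.filter (fun i : ℕ => 1 + (2 : ℝ) ^ ((i : ℤ) - (n : ℤ)) ≤ γ)
      (Finset.Icc 1 n)).card := by
  obtain ⟨k, hk⟩ := exists_pow_lt_of_lt_one (sub_pos.2 hγ) (by norm_num : (1 / 2 : ℝ) < 1)
  refine ⟨1 / 2, by norm_num, ?_⟩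
  filter_upwards [eventually_ge_atTop (2 * k)] with n hn
  refine le_trans ?_ (natCast_le_card_filter (m := n - k) (by omega) fun i _ hi => ?_)
  · rw [Nat.cast_sub (by omega)]
    have : (2 * k : ℝ) ≤ n := by exact_mod_cast hn
    linarith
  · have h1 : (2 : ℝ) ^ ((i : ℤ) - (n : ℤ)) ≤ (2 : ℝ) ^ (-(k : ℤ)) :=
      zpow_le_zpow_right₀ one_le_two (by omega)
    rw [zpow_neg, zpow_natCast, ← inv_pow, ← one_div] at h1
    linarith

theorem sum_div_rpow_bounds {α : ℝ} (hα : 0 < α) {n : ℕ} (hn : 0 < n) :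
    1 / (α + 1) ≤ (∑ k ∈ Finset.Icc 1 n, ((k : ℝ) / n) ^ α) / n ∧
      (∑ k ∈ Finset.Icc 1 n, ((k : ℝ) / n) ^ α) / n ≤ 1 / (α + 1) + 1 / n := by
  have hn0 : (0 : ℝ) < n := by exact_mod_cast hn
  have hmono : MonotoneOn (fun x : ℝ => (x / n) ^ α) (Set.Icc ((0 : ℕ) : ℝ) n) := by
    intro x hx y _ hxy
    have : 0 ≤ x := by simpa using hx.1
    dsimp only
    gcongr
  have hint : ∫ x in ((0 : ℕ) : ℝ)..n, (x / n) ^ α = n / (α + 1) := by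
    rw [intervalIntegral.integral_comp_div (fun x => x ^ α) hn0.ne', integral_rpow
      (Or.inl (by linarith)), div_self hn0.ne', Real.one_rpow]
    have : α + 1 ≠ 0 := by positivity
    simp [Real.zero_rpow this, div_eq_mul_inv]
  have h1 := hmono.integral_le_sum_Ico (Nat.zero_le n)
  have h2 := hmono.sum_le_integral_Ico (Nat.zero_le n)
  rw [hint] at h1 h2
  have e1 : ∑ i ∈ Finset.Ico 0 n, (((i + 1 : ℕ) : ℝ) / n) ^ α
      = ∑ k ∈ Finset.Icc 1 n, ((k : ℝ) / n) ^ α := by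
    rw [Finset.sum_Ico_add' (fun k : ℕ => ((k : ℝ) / n) ^ α) 0 n 1]
    rfl
  -- The upper and lower Riemann sums differ by the last term, equal to `1`; hence the error `1 /
  -- n`.
  have e2 : ∑ k ∈ Finset.Icc 1 n, ((k : ℝ) / n) ^ α
      = (∑ i ∈ Finset.Ico 0 n, ((i : ℝ) / n) ^ α) + 1 := by
    rw [← e1, Nat.Ico_zero_eq_range]
    have := Finset.sum_range_succ (fun i : ℕ => ((i : ℝ) / n) ^ α) n
    rw [Finset.sum_range_succ'] at this
    simpa [Real.zero_rpow hα.ne', div_self hn0.ne'] using this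
  rw [e1] at h1
  constructor
  · rw [le_div_iff₀ hn0, one_div_mul_eq_div]
    exact h1
  · rw [div_le_iff₀ hn0, add_mul, one_div_mul_eq_div, one_div_mul_cancel hn0.ne', e2]
    linarith

theorem isModerateWeight_rpow {α : ℝ} (hα : 0 < α) :
    IsModerateWeight (fun n i => 1 + ((i : ℝ) / (n : ℝ)) ^ α) ((α + 2) / (α + 1)) := by
  refine ⟨by positivity, fun n i _ _ _ => ?_, fun n i hn _ hi => ?_, ?_⟩
  · have : 0 ≤ ((i : ℝ) / (n : ℝ)) ^ α := by positivity
    linarith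
  · have hn0 : (0 : ℝ) < n := by positivity
    have : ((i : ℝ) / (n : ℝ)) ^ α ≤ 1 := by
      refine Real.rpow_le_one (by positivity) ?_ hα.le
      rw [div_le_one hn0]
      exact_mod_cast hi
    linarith
  · have hQ : (α + 2) / (α + 1) = 1 + 1 / (α + 1) := by
      field_simp
      ring
    have hlim : Tendsto (fun n : ℕ => 1 + (1 / (α + 1) + 1 / (n : ℝ))) atTop
        (𝓝 ((α + 2) / (α + 1))) := by
      rw [hQ]
      simpa using ((tendsto_const_div_atTop_nhds_zero_nat (1 : ℝ)).const_add
        (1 / (α + 1))).const_add 1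
    refine tendsto_of_tendsto_of_tendsto_of_le_of_le' tendsto_const_nhds hlim ?_ ?_
    all_goals
      filter_upwards [eventually_gt_atTop 0] with n hn
      have hn0 : (0 : ℝ) < n := by exact_mod_cast hn
      rw [Finset.sum_add_distrib, Finset.sum_const, Nat.card_Icc, Nat.add_sub_cancel, nsmul_eq_mul,
        mul_one, add_div (n : ℝ), div_self hn0.ne']
    · rw [hQ]
      linarith [(sum_div_rpow_bounds hα hn).1]
    · linarith [(sum_div_rpow_bounds hα hn).2]

/-- The indices `i ≤ σ n` qualify for `σ < (γ - 1) ^ (1/α)`; `n ≥ 2 / σ` makes the rounding cost at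
most half of them. -/
theorem bulk_rpow {α : ℝ} (hα : 0 < α) (γ : ℝ) (hγ : 1 < γ) :
    ∃ ρ : ℝ, 0 < ρ ∧ ∀ᶠ n : ℕ in atTop,
      ρ * n ≤ (Finset.filter (fun i : ℕ => 1 + ((i : ℝ) / (n : ℝ)) ^ α ≤ γ)
        (Finset.Icc 1 n)).card := by
  obtain ⟨σ, hσ0, hσ⟩ : ∃ σ, 0 < σ ∧ σ < min 1 ((γ - 1) ^ α⁻¹) :=
    exists_between (lt_min one_pos (Real.rpow_pos_of_pos (by linarith) _))
  obtain ⟨hσ1, hσγ⟩ := lt_min_iff.1 hσ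
  refine ⟨σ / 2, by positivity, ?_⟩
  filter_upwards [tendsto_natCast_atTop_atTop.eventually_ge_atTop (2 / σ),
    eventually_gt_atTop 0] with n hn hn1
  have hn0 : (0 : ℝ) < n := by exact_mod_cast hn1
  rw [div_le_iff₀ hσ0] at hn
  have hfl : (⌊σ * n⌋₊ : ℝ) ≤ σ * n := Nat.floor_le (by positivity)
  refine le_trans ?_ (natCast_le_card_filter (m := ⌊σ * n⌋₊) ?_ fun i _ hi => ?_)
  · have := Nat.lt_floor_add_one (σ * n)
    linarith
  · have : (⌊σ * n⌋₊ : ℝ) ≤ n := hfl.trans (mul_le_of_le_one_left hn0.le hσ1.le)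
    exact_mod_cast this
  · have hi' : (i : ℝ) ≤ σ * n := le_trans (by exact_mod_cast hi) hfl
    have h1 : ((i : ℝ) / n) ^ α ≤ ((γ - 1) ^ α⁻¹) ^ α := by
      refine Real.rpow_le_rpow (by positivity) ?_ hα.le
      rw [div_le_iff₀ hn0]
      exact hi'.trans (by gcongr)
    rw [Real.rpow_inv_rpow (by linarith) hα.ne'] at h1
    linarith

theorem sum_log_bounds (n : ℕ) : n * Real.log n - n ≤ ∑ k ∈ Finset.Icc 1 n, Real.log k ∧
    ∑ k ∈ Finset.Icc 1 n, Real.log k ≤ n * Real.log n := by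
  constructor
  · rcases Nat.eq_zero_or_pos n with rfl | hn
    · simp
    have hn0 : (0 : ℝ) < n := by exact_mod_cast hn
    have hf : (0 : ℝ) < n.factorial := by positivity
    have hsum : ∑ k ∈ Finset.Icc 1 n, Real.log k = Real.log n.factorial := by
      rw [← Finset.prod_Ico_id_eq_factorial, Nat.cast_prod, Real.log_prod]
      · rfl
      intro k hk
      have := (Finset.mem_Icc.1 hk).1
      positivity
    -- The bound `n ^ n / n! ≤ e ^ n` gives the lower estimate of `log n!`.
    have h := Real.pow_div_factorial_le_exp (n : ℝ) hn0.le n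
    have h2 := Real.log_le_log (by positivity) h
    rw [Real.log_exp, Real.log_div (by positivity) hf.ne', Real.log_pow] at h2
    rw [hsum]
    linarith
  · calc ∑ k ∈ Finset.Icc 1 n, Real.log k ≤ ∑ k ∈ Finset.Icc 1 n, Real.log n := by
          refine Finset.sum_le_sum fun k hk => ?_
          rw [Finset.mem_Icc] at hk
          exact Real.log_le_log (by exact_mod_cast hk.1) (by exact_mod_cast hk.2)
      _ = n * Real.log n := by
          rw [Finset.sum_const, Nat.card_Icc, Nat.add_sub_cancel, nsmul_eq_mul]

theorem isModerateWeight_log :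
    IsModerateWeight (fun n i => 1 + Real.log i / Real.log n) 2 := by
  refine ⟨two_pos, fun n i _ _ _ => ?_, fun n i hn h1 hi => ?_, ?_⟩
  · have : 0 ≤ Real.log i / Real.log n :=
      div_nonneg (Real.log_natCast_nonneg i) (Real.log_natCast_nonneg n)
    linarith
  · have hlog : 0 < Real.log n := Real.log_pos (by exact_mod_cast (by omega : 1 < n))
    have : Real.log i / Real.log n ≤ 1 := by
      rw [div_le_one hlog]
      exact Real.log_le_log (by exact_mod_cast h1) (by exact_mod_cast hi)
    linarith
  · have hlim : Tendsto (fun n : ℕ => 2 - 1 / Real.log n) atTop (𝓝 2) := by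
      have := (Real.tendsto_log_atTop.comp tendsto_natCast_atTop_atTop).inv_tendsto_atTop
        (α := ℕ)
      simpa using this.const_sub 2
    refine tendsto_of_tendsto_of_tendsto_of_le_of_le' hlim tendsto_const_nhds ?_ ?_
    all_goals
      filter_upwards [eventually_gt_atTop 1] with n hn
      have hn0 : (0 : ℝ) < n := by positivity
      have hlog : 0 < Real.log n := Real.log_pos (by exact_mod_cast hn)
      rw [Finset.sum_add_distrib, Finset.sum_const, Nat.card_Icc, Nat.add_sub_cancel, nsmul_eq_mul,
        mul_one, add_div, div_self hn0.ne', ← Finset.sum_div, div_div]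
      obtain ⟨h1, h2⟩ := sum_log_bounds n
    · have : 1 - 1 / Real.log n ≤ (∑ k ∈ Finset.Icc 1 n, Real.log k) / (Real.log n * n) := by
        rw [le_div_iff₀ (by positivity)]
        refine le_trans (le_of_eq ?_) h1
        field_simp
      linarith
    · have : (∑ k ∈ Finset.Icc 1 n, Real.log k) / (Real.log n * n) ≤ 1 := by
        rw [div_le_one (by positivity)]
        linarith
      linarith

theorem log_weight_le_iff {n i : ℕ} (hn : 2 ≤ n) (hi : 1 ≤ i) (s : ℝ) :
    1 + Real.log i / Real.log n ≤ 1 + s ↔ (i : ℝ) ≤ (n : ℝ) ^ s := by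
  have hn0 : (0 : ℝ) < n := by positivity
  have hi0 : (0 : ℝ) < i := by exact_mod_cast hi
  have hlog : 0 < Real.log n := Real.log_pos (by exact_mod_cast (by omega : 1 < n))
  rw [add_le_add_iff_left, div_le_iff₀ hlog, Real.le_rpow_iff_log_le hi0 hn0]

/-- About `n ^ s` weights are at most `1 + s`, so `s = β` is the critical level, unless `β ≥ 1`,
when the fast path of the first coordinate decides. -/
theorem IsLacoinFamily.isCutoffTime_log {β : ℝ} {a b c : ℕ → ℕ → ℝ}
    {π : ∀ n : ℕ, ℕ → Fin (2 * n + 1) → ℝ} {C : ℝ} (hF : IsLacoinFamily β a b c π C) :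
    IsCutoffTime (lacoinProductDistance β a b c π (fun n i => 1 + Real.log i / Real.log n))
      (fun n => 4 * (n : ℝ) ^ 2 / (1 + min β 1)) := by
  have hW := isModerateWeight_log
  have hβ := hF.beta_pos
  set μ := min β 1 with hμ
  have hμ0 : 0 < μ := lt_min hβ one_pos
  have hμ1 : μ ≤ 1 := min_le_right _ _
  have hμβ : μ ≤ β := min_le_left _ _
  have htime : ∀ (r : ℝ) (n : ℕ), r * (4 * (n : ℝ) ^ 2 / (1 + μ))
      = 2 * r / (1 + μ) * 2 * (n : ℝ) ^ 2 := fun r n => by ring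
  refine ⟨?_, fun r hr => ?_, fun r hr0 hr1 => ?_⟩
  · filter_upwards [eventually_ge_atTop 1] with n hn
    have : (0 : ℝ) < n := by exact_mod_cast hn
    positivity
  · simp only [htime]
    -- The lower bound on `s` says `γ * θ > 2` for `γ = 1 + s`; `s < μ ≤ β` makes the normalized
    -- count, at most `n ^ (s - β)`, vanish.
    obtain ⟨s, hs, hsμ⟩ : ∃ s, (1 + μ) / r - 1 < s ∧ s < μ := by
      refine exists_between ?_
      rw [sub_lt_iff_lt_add, div_lt_iff₀ (by linarith)]
      nlinarith
    rw [sub_lt_iff_lt_add, div_lt_iff₀ (by linarith)] at hs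
    refine hF.tendsto_distance_zero hW (γ := 1 + s) ?_ ?_ ?_
    · rw [lt_div_iff₀ (by linarith)]
      linarith
    · rw [mul_div_assoc', lt_div_iff₀ (by linarith)]
      linarith
    · have hlim : Tendsto (fun n : ℕ => (n : ℝ) ^ (s - β)) atTop (𝓝 0) := by
        simpa using tendsto_natCast_rpow_neg (by linarith : 0 < β - s)
      refine tendsto_of_tendsto_of_tendsto_of_le_of_le' tendsto_const_nhds hlim
        (Eventually.of_forall fun n => by positivity) ?_
      filter_upwards [eventually_ge_atTop 2] with n hn
      have hn0 : (0 : ℝ) < n := by positivity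
      rw [sub_eq_neg_add, Real.rpow_add hn0]
      gcongr
      have hsub : Finset.filter (fun i : ℕ => 1 + Real.log i / Real.log n < 1 + s)
          (Finset.Icc 1 n) ⊆ Finset.Icc 1 ⌊(n : ℝ) ^ s⌋₊ := by
        intro i hi
        rw [Finset.mem_filter, Finset.mem_Icc] at hi
        exact Finset.mem_Icc.2 ⟨hi.1.1, Nat.le_floor ((log_weight_le_iff hn hi.1.1 s).1 hi.2.le)⟩
      have hle := Finset.card_le_card hsub
      rw [Nat.card_Icc, Nat.add_sub_cancel] at hle
      exact le_trans (by exact_mod_cast hle) (Nat.floor_le (by positivity))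
  · simp only [htime]
    rcases le_or_gt 1 β with h1β | h1β
    · have hμ' : μ = 1 := min_eq_right h1β
      refine hF.tendsto_distance_one_of_exists hW (γ := 1) (by positivity) ?_ ?_
      · rw [hμ', one_mul, div_lt_one (by norm_num)]
        linarith
      · filter_upwards [eventually_ge_atTop 1] with n hn
        -- The first weight is exactly `1`, as `log 1 = 0`.
        exact ⟨1, le_rfl, hn, by simp⟩
    · have hμ' : μ = β := min_eq_left h1β.le
      rw [hμ']
      -- `s > β` makes the normalized count diverge, `s < 1` keeps `n ^ s` within the index range,
      -- and the last bound says `γ * θ < 2`.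
      obtain ⟨s, hsβ, hs⟩ : ∃ s, β < s ∧ s < min 1 ((1 + β) / r - 1) := by
        refine exists_between (lt_min h1β ?_)
        rw [lt_sub_iff_add_lt, lt_div_iff₀ hr0]
        nlinarith
      obtain ⟨hs1, hs2⟩ := lt_min_iff.1 hs
      rw [lt_sub_iff_add_lt, lt_div_iff₀ hr0] at hs2
      refine hF.tendsto_distance_one hW (γ := 1 + s) (by positivity) (by linarith) ?_ ?_
      · rw [mul_div_assoc', div_lt_iff₀ (by linarith)]
        linarith
      · have hlim : Tendsto (fun n : ℕ => 1 / 2 * (n : ℝ) ^ (s - β)) atTop atTop :=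
          ((tendsto_rpow_atTop (by linarith)).comp
            tendsto_natCast_atTop_atTop).const_mul_atTop (by norm_num)
        have hlarge : Tendsto (fun n : ℕ => (n : ℝ) ^ s) atTop atTop :=
          (tendsto_rpow_atTop (by linarith)).comp tendsto_natCast_atTop_atTop
        refine tendsto_atTop_mono' _ ?_ hlim
        filter_upwards [eventually_ge_atTop 2, hlarge.eventually_ge_atTop 2] with n hn hns
        have hn0 : (0 : ℝ) < n := by positivity
        have hn1 : (1 : ℝ) ≤ n := by exact_mod_cast (by omega : 1 ≤ n)
        have hfl : (⌊(n : ℝ) ^ s⌋₊ : ℝ) ≤ (n : ℝ) ^ s := Nat.floor_le (by positivity)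
        rw [sub_eq_neg_add, Real.rpow_add hn0, mul_left_comm]
        gcongr
        refine le_trans ?_ (natCast_le_card_filter (m := ⌊(n : ℝ) ^ s⌋₊) ?_ fun i h1 hi => ?_)
        · have := Nat.lt_floor_add_one ((n : ℝ) ^ s)
          linarith
        · have : (⌊(n : ℝ) ^ s⌋₊ : ℝ) ≤ n :=
            hfl.trans ((Real.rpow_le_rpow_of_exponent_le hn1 hs1.le).trans_eq (Real.rpow_one _))
          exact_mod_cast this
        · exact (log_weight_le_iff hn h1 s).2 (le_trans (by exact_mod_cast hi) hfl)

end Weights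

theorem proposition1p3 (β : ℝ) (hβ : 0 < β) (a b c : ℕ → ℕ → ℝ)
    (π : ∀ n : ℕ, ℕ → Fin (2 * n + 1) → ℝ)
    (hchain : ∀ n i : ℕ, 2 ≤ n → 1 ≤ i → i ≤ n →
      IsIrreducibleChain (lacoinKernel β n (a n i) (b n i) (c n i)) (π n i))
    (hrev : ∀ n i : ℕ, 2 ≤ n → 1 ≤ i → i ≤ n →
      b n i * c n i * (1 - a n i) ^ (n - 1) * (n : ℝ) ^ (-β)
        = (1 - a n i - b n i * (n : ℝ) ^ (-β)) * a n i ^ n)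
    (C : ℝ) (hC : 1 < C)
    (hsum : ∀ n : ℕ, 2 ≤ n → ∑ i ∈ Finset.Icc 1 n, a n i ≤ C * (n : ℝ) ^ (-β - 1))
    (hb : ∀ n i : ℕ, 2 ≤ n → 1 ≤ i → i ≤ n → C⁻¹ ≤ b n i ∧ b n i ≤ C) :
    -- weights `1 + 2 ^ (i - n)`
    ((HasCutoff (lacoinProductDistance β a b c π
          (fun n i => 1 + (2 : ℝ) ^ ((i : ℤ) - (n : ℤ)))) ↔ β ≠ 1) ∧
      (β < 1 → IsCutoffTime (lacoinProductDistance β a b c π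
          (fun n i => 1 + (2 : ℝ) ^ ((i : ℤ) - (n : ℤ))))
        (fun n => 2 * (n : ℝ) ^ 2)) ∧
      (1 < β → IsCutoffTime (lacoinProductDistance β a b c π
          (fun n i => 1 + (2 : ℝ) ^ ((i : ℤ) - (n : ℤ))))
        (fun n => (n : ℝ) ^ 2))) ∧
    -- weights `1 + (i / n) ^ α`
    (∀ α : ℝ, 0 < α →
      (HasCutoff (lacoinProductDistance β a b c π
          (fun n i => 1 + ((i : ℝ) / (n : ℝ)) ^ α)) ↔ β ≠ 1) ∧
      (β < 1 → IsCutoffTime (lacoinProductDistance β a b c π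
          (fun n i => 1 + ((i : ℝ) / (n : ℝ)) ^ α))
        (fun n => 2 * ((α + 2) / (α + 1)) * (n : ℝ) ^ 2)) ∧
      (1 < β → IsCutoffTime (lacoinProductDistance β a b c π
          (fun n i => 1 + ((i : ℝ) / (n : ℝ)) ^ α))
        (fun n => (α + 2) / (α + 1) * (n : ℝ) ^ 2))) ∧
    -- weights `1 + log i / log n`
    IsCutoffTime (lacoinProductDistance β a b c π
        (fun n i => 1 + Real.log i / Real.log n))
      (fun n => 4 * (n : ℝ) ^ 2 / (1 + min β 1)) := by
  have hF : IsLacoinFamily β a b c π C := ⟨hβ, hC, hchain, hrev, hsum, hb⟩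
  refine ⟨⟨hF.hasCutoff_iff isModerateWeight_zpow bulk_zpow, fun h => ?_, fun h => ?_⟩,
    fun α hα => ⟨hF.hasCutoff_iff (isModerateWeight_rpow hα) (bulk_rpow hα),
      hF.isCutoffTime_of_lt_one (isModerateWeight_rpow hα) (bulk_rpow hα),
      hF.isCutoffTime_of_one_lt (isModerateWeight_rpow hα) (bulk_rpow hα)⟩,
    hF.isCutoffTime_log⟩
  · simpa only [mul_one] using hF.isCutoffTime_of_lt_one isModerateWeight_zpow bulk_zpow h
  · simpa only [one_mul] using hF.isCutoffTime_of_one_lt isModerateWeight_zpow bulk_zpow h
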